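/- Let $n\ge 1$. All cubes are cubes in $\mathbb{R}^n$ of positive side length with sides parallel to the coordinate axes. For a real-valued locally integrable function $f$ on $\mathbb{R}^n$ put $$Mf(x)=\sup_{Q\ni x}\frac1{|Q|}\int_Q|f|,\qquad \|f\|_{\mathrm{BMO}}=\sup_Q\frac1{|Q|}\int_Q|f-f_Q|,\qquad f_Q=\frac1{|Q|}\int_Q f .$$ A weight is a nonnegative locally integrable function $w$ on $\mathbb{R}^n$ that is not almost everywhere zero; $w(Q)=\int_Q w$. Put $$[w]_{A_\infty}=\sup_Q\frac1{w(Q)}\int_Q M(w\chi_Q)\,dx\in[0,\infty],\qquad \|F\|_{\mathrm{BLO}_w}=\sup_Q\frac1{w(Q)}\int_Q\bigl(F-\operatorname*{ess\,inf}_Q F\bigr)\,w\,dx,$$ where cubes with $w(Q)=0$, if there are any, are disregarded; $w\in A_\infty$ means $[w]_{A_\infty}<\infty$. **Theorem.** There are constants $0<c_n,C_n<\infty$ depending only on $n$ such that for every weight $w$ $$c_n[w]_{A_\infty}\le \sup_f\|Mf\|_{\mathrm{BLO}_w}\le C_n[w]_{A_\infty},$$ where the supremum is over all real-valued locally integrable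 functions $f$ such that $\|f\|_{\mathrm{BMO}}=1$ and $Mf$ is not identically infinite; the quantities may be infinite. Consequently, $$c_n[w]_{A_\infty}\le \sup_f\sup_Q\frac1{w(Q)}\int_Q\bigl(Mf(x)-\operatorname*{ess\,inf}_Q Mf\bigr)w(x)\,dx\le C_n[w]_{A_\infty},$$ with the supremum over the same $f$ and all cubes $Q$, and $w\in A_\infty$ if and only if $\sup_f\|Mf\|_{\mathrm{BLO}_w}<\infty$. -/

import Mathlib

open MeasureTheory
open scoped ENNReal NNReal

noncomputable section

namespace BLOWeights

/-- The closed cube in `ℝⁿ` with sides parallel to the coordinate axes, lowest corner `a` and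
side length `l`. All suprema over cubes below are over those with `0 < l`. -/
def cube {n : ℕ} (a : Fin n → ℝ) (l : ℝ) : Set (Fin n → ℝ) :=
  Set.Icc a (fun i => a i + l)

/-- The (uncentred) Hardy-Littlewood maximal function
`Mf(x) = sup_{Q ∋ x} |Q|⁻¹ ∫_Q |f|`, with values in `[0, ∞]`. -/
def maximalFn {n : ℕ} (f : (Fin n → ℝ) → ℝ) (x : Fin n → ℝ) : ℝ≥0∞ :=
  ⨆ (a : Fin n → ℝ) (l : ℝ) (_ : 0 < l) (_ : x ∈ cube a l),
    (∫⁻ y in cube a l, ‖f y‖ₑ) / volume (cube a l)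

/-- The seminorm `‖f‖_BMO = sup_Q |Q|⁻¹ ∫_Q |f - f_Q|` of a locally integrable function `f`,
with values in `[0, ∞]`. -/
def bmoNorm {n : ℕ} (f : (Fin n → ℝ) → ℝ) : ℝ≥0∞ :=
  ⨆ (a : Fin n → ℝ) (l : ℝ) (_ : 0 < l),
    (∫⁻ x in cube a l, ‖f x - ⨍ y in cube a l, f y‖ₑ) / volume (cube a l)

/-- A weight: a nonnegative locally integrable function which is not almost everywhere zero. -/
structure IsWeight {n : ℕ} (w : (Fin n → ℝ) → ℝ) : Prop where
  locallyIntegrable : LocallyIntegrable w volume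
  nonneg : 0 ≤ᵐ[volume] w
  ne_zero : ¬ w =ᵐ[volume] 0

/-- `w(E) = ∫_E w`, for a nonnegative function `w`. -/
def weightMass {n : ℕ} (w : (Fin n → ℝ) → ℝ) (E : Set (Fin n → ℝ)) : ℝ≥0∞ :=
  ∫⁻ x in E, ENNReal.ofReal (w x)

/-- The Fujii-Wilson constant `[w]_{A_∞} = sup_Q w(Q)⁻¹ ∫_Q M(w χ_Q)`, with values in `[0, ∞]`.
If `w(Q) = 0`, then `M(w χ_Q) = 0` and the quotient `0 / 0` is `0`, so that such a cube does
not contribute. -/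
def fujiiWilson {n : ℕ} (w : (Fin n → ℝ) → ℝ) : ℝ≥0∞ :=
  ⨆ (a : Fin n → ℝ) (l : ℝ) (_ : 0 < l),
    (∫⁻ x in cube a l, maximalFn ((cube a l).indicator w) x) / weightMass w (cube a l)

/-- The class `A_∞`: the weights with finite Fujii-Wilson constant. -/
def IsAInfty {n : ℕ} (w : (Fin n → ℝ) → ℝ) : Prop :=
  IsWeight w ∧ fujiiWilson w < ∞

/-- The average `w(Q)⁻¹ ∫_Q (F - ess inf_Q F) w` of a measurable function `F ≥ 0` that is finite
almost everywhere. The subtraction is that of `[0, ∞]`; as `F ≥ ess inf_Q F` almost everywhere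
in `Q`, truncation only occurs on a null set. If `w(Q) = 0` then the quotient is `0 / 0 = 0`. -/
def lowerOsc {n : ℕ} (w : (Fin n → ℝ) → ℝ) (F : (Fin n → ℝ) → ℝ≥0∞)
    (Q : Set (Fin n → ℝ)) : ℝ≥0∞ :=
  (∫⁻ x in Q, (F x - essInf F (volume.restrict Q)) * ENNReal.ofReal (w x)) / weightMass w Q

/-- The seminorm `‖F‖_{BLO_w} = sup_Q w(Q)⁻¹ ∫_Q (F - ess inf_Q F) w`. -/
def bloNorm {n : ℕ} (w : (Fin n → ℝ) → ℝ) (F : (Fin n → ℝ) → ℝ≥0∞) : ℝ≥0∞ :=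
  ⨆ (a : Fin n → ℝ) (l : ℝ) (_ : 0 < l), lowerOsc w F (cube a l)

/-- The locally integrable functions `f` with `‖f‖_BMO = 1` and `Mf` not identically infinite. -/
def Admissible {n : ℕ} (f : (Fin n → ℝ) → ℝ) : Prop :=
  LocallyIntegrable f volume ∧ bmoNorm f = 1 ∧ ∃ x, maximalFn f x ≠ ∞

end BLOWeights

end

namespace BLOWeights

variable {n : ℕ}

lemma measurableSet_cube (a : Fin n → ℝ) (l : ℝ) : MeasurableSet (cube a l) :=
  measurableSet_Icc

lemma isCompact_cube (a : Fin n → ℝ) (l : ℝ) : IsCompact (cube a l) :=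
  isCompact_Icc

lemma mem_cube {a x : Fin n → ℝ} {l : ℝ} :
    x ∈ cube a l ↔ ∀ i, a i ≤ x i ∧ x i ≤ a i + l := by
  simp [cube, Set.mem_Icc, Pi.le_def, forall_and]

lemma volume_cube (a : Fin n → ℝ) (l : ℝ) : volume (cube a l) = ENNReal.ofReal l ^ n := by
  simp [cube, Real.volume_Icc_pi]

lemma volume_cube_ne_zero (a : Fin n → ℝ) {l : ℝ} (hl : 0 < l) : volume (cube a l) ≠ 0 := by
  rw [volume_cube]; exact pow_ne_zero _ (by simpa using hl)

lemma volume_cube_ne_top (a : Fin n → ℝ) (l : ℝ) : volume (cube a l) ≠ ∞ := by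
  rw [volume_cube]; finiteness

lemma volume_cube_mul (a b : Fin n → ℝ) (k : ℕ) (l : ℝ) :
    volume (cube a (k * l)) = (k : ℝ≥0∞) ^ n * volume (cube b l) := by
  rw [volume_cube, volume_cube, ENNReal.ofReal_mul (by positivity), mul_pow]
  simp

lemma cube_subset_cube {a b : Fin n → ℝ} {l r : ℝ} (h : ∀ i, b i ≤ a i)
    (h' : ∀ i, a i + l ≤ b i + r) : cube a l ⊆ cube b r :=
  Set.Icc_subset_Icc h h'

lemma cube_eq_closedBall (a : Fin n → ℝ) {l : ℝ} (hl : 0 ≤ l) :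
    cube a l = Metric.closedBall (fun i => a i + l / 2) (l / 2) := by
  rw [closedBall_pi _ (by positivity)]
  ext x
  simp only [mem_cube, Real.closedBall_eq_Icc, Set.mem_pi, Set.mem_univ, Set.mem_Icc, true_imp_iff]
  refine forall_congr' fun i => ?_
  constructor <;> rintro ⟨h1, h2⟩ <;> constructor <;> linarith

/-- Two intersecting cubes lie in a cube whose side is the sum of their sides. -/
lemma exists_cube_superset {a b x : Fin n → ℝ} {l r : ℝ} (ha : x ∈ cube a l) (hb : x ∈ cube b r) :
    ∃ c, cube a l ⊆ cube c (l + r) ∧ cube b r ⊆ cube c (l + r) := by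
  rw [mem_cube] at ha hb
  refine ⟨fun i => min (a i) (b i), cube_subset_cube (fun i => min_le_left _ _) fun i => ?_,
    cube_subset_cube (fun i => min_le_right _ _) fun i => ?_⟩
  all_goals
    have h1 := ha i
    have h2 := hb i
    rcases min_choice (a i) (b i) with h | h <;> rw [h] <;> linarith

/-- The uncentred maximal operator on `[0, ∞]`-valued functions. -/
noncomputable def maxOp (u : (Fin n → ℝ) → ℝ≥0∞) (x : Fin n → ℝ) : ℝ≥0∞ :=
  ⨆ (a : Fin n → ℝ) (l : ℝ) (_ : 0 < l) (_ : x ∈ cube a l),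
    (∫⁻ y in cube a l, u y) / volume (cube a l)

lemma average_le_maxOp (u : (Fin n → ℝ) → ℝ≥0∞) {a x : Fin n → ℝ} {l : ℝ} (hl : 0 < l)
    (hx : x ∈ cube a l) : (∫⁻ y in cube a l, u y) / volume (cube a l) ≤ maxOp u x :=
  le_iSup₂_of_le a l (le_iSup₂_of_le hl hx le_rfl)

lemma maxOp_le_iff {u : (Fin n → ℝ) → ℝ≥0∞} {x : Fin n → ℝ} {t : ℝ≥0∞} :
    maxOp u x ≤ t ↔ ∀ a l, 0 < l → x ∈ cube a l →
      (∫⁻ y in cube a l, u y) / volume (cube a l) ≤ t := by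
  simp [maxOp]

lemma lt_maxOp_iff {u : (Fin n → ℝ) → ℝ≥0∞} {x : Fin n → ℝ} {t : ℝ≥0∞} :
    t < maxOp u x ↔ ∃ a l, 0 < l ∧ x ∈ cube a l ∧ t * volume (cube a l) < ∫⁻ y in cube a l, u y := by
  rw [← not_le, maxOp_le_iff]
  push Not
  refine exists_congr fun a => exists_congr fun l => ?_
  refine and_congr_right fun hl => and_congr_right fun _ => ?_
  rw [ENNReal.lt_div_iff_mul_lt (.inl (volume_cube_ne_zero a hl)) (.inl (volume_cube_ne_top a l))]

lemma maxOp_mono {u v : (Fin n → ℝ) → ℝ≥0∞} (h : u ≤ v) : maxOp u ≤ maxOp v := fun _ =>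
  maxOp_le_iff.2 fun _ _ hl hx =>
    (ENNReal.div_le_div_right (lintegral_mono h) _).trans (average_le_maxOp v hl hx)

lemma maxOp_congr_ae {u v : (Fin n → ℝ) → ℝ≥0∞} (h : u =ᵐ[volume] v) : maxOp u = maxOp v := by
  ext x
  have key (a : Fin n → ℝ) (l : ℝ) : ∫⁻ y in cube a l, u y = ∫⁻ y in cube a l, v y :=
    lintegral_congr_ae (ae_restrict_of_ae h)
  simp [maxOp, key]

lemma isOpen_lt_maxOp (u : (Fin n → ℝ) → ℝ≥0∞) (t : ℝ≥0∞) : IsOpen {x | t < maxOp u x} := by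
  refine isOpen_iff_mem_nhds.2 fun x hx => ?_
  obtain ⟨a, l, hl, hxa, h⟩ := lt_maxOp_iff.1 hx
  have ht : t ≠ ∞ := fun h' => by simp [h'] at hx
  have hcont : Continuous fun ε : ℝ => t * ENNReal.ofReal (l + 2 * ε) ^ n := by
    refine ENNReal.continuous_const_mul ht |>.comp ?_
    exact (ENNReal.continuous_pow n).comp (ENNReal.continuous_ofReal.comp (by fun_prop))
  have h0 : t * ENNReal.ofReal (l + 2 * 0) ^ n < ∫⁻ y in cube a l, u y := by
    rwa [mul_zero, add_zero, ← volume_cube a]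
  have hev := (hcont.tendsto 0).eventually (gt_mem_nhds h0)
  obtain ⟨ε, hε, hε0⟩ :=
    ((hev.filter_mono nhdsWithin_le_nhds).and (self_mem_nhdsWithin (s := Set.Ioi (0 : ℝ)))).exists
  have hε0 : 0 < ε := hε0
  have hsub : cube a l ⊆ cube (fun i => a i - ε) (l + 2 * ε) :=
    cube_subset_cube (fun i => by linarith) fun i => by linarith
  refine Filter.mem_of_superset (Metric.ball_mem_nhds x hε0) fun y hy => ?_
  refine lt_maxOp_iff.2 ⟨fun i => a i - ε, l + 2 * ε, by linarith, ?_, ?_⟩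
  · rw [mem_cube] at hxa ⊢
    intro i
    have := (dist_pi_lt_iff hε0).1 hy i
    rw [Real.dist_eq, abs_lt] at this
    have := hxa i
    constructor <;> linarith
  · rw [volume_cube]
    exact hε.trans_le (lintegral_mono_set hsub)

/-- The localized weak type estimate of the maximal operator. -/
lemma mul_volume_lt_maxOp_le (hn : n ≠ 0) {u : (Fin n → ℝ) → ℝ≥0∞} (hu : ∫⁻ x, u x ≠ ∞)
    (t : ℝ≥0∞) :
    t * volume {x | t < maxOp u x} ≤ 5 ^ n * ∫⁻ x in {x | t < maxOp u x}, u x := by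
  rcases eq_or_ne t 0 with rfl | ht0
  · simp
  rcases eq_or_ne t ∞ with rfl | ht
  · simp
  set U := {x | t < maxOp u x}
  let ι := (Fin n → ℝ) × ℝ
  let S : Set ι := {p | 0 < p.2 ∧ t * volume (cube p.1 p.2) < ∫⁻ y in cube p.1 p.2, u y}
  have hR : ∀ p ∈ S, p.2 / 2 ≤ max 1 ((∫⁻ x, u x) / t).toReal := by
    rintro ⟨a, l⟩ ⟨hl, h⟩
    dsimp only at hl h ⊢
    rcases le_or_gt l 1 with h1 | h1
    · exact le_max_of_le_left (by linarith)
    · refine le_max_of_le_right ?_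
      have h2 : ENNReal.ofReal (l ^ n) ≤ (∫⁻ x, u x) / t := by
        rw [ENNReal.le_div_iff_mul_le (.inl ht0) (.inl ht), mul_comm, ENNReal.ofReal_pow hl.le,
          ← volume_cube a]
        exact h.le.trans (setLIntegral_le_lintegral _ _)
      have h3 : l ^ n ≤ ((∫⁻ x, u x) / t).toReal :=
        (ENNReal.ofReal_le_iff_le_toReal (ENNReal.div_ne_top hu ht0)).1 h2
      have h4 : l ≤ l ^ n := le_self_pow₀ h1.le hn
      linarith
  obtain ⟨V, hVS, hdisj, hcov⟩ := Vitali.exists_disjoint_subfamily_covering_enlargement_closedBall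
    S (fun p i => p.1 i + p.2 / 2) (fun p => p.2 / 2) _ hR 5 (by norm_num)
  have hcube : ∀ p ∈ V, Metric.closedBall (fun i => p.1 i + p.2 / 2) (p.2 / 2) = cube p.1 p.2 :=
    fun p hp => (cube_eq_closedBall _ (hVS hp).1.le).symm
  have hVc : V.Countable := by
    refine hdisj.countable_of_nonempty_interior fun p hp => ?_
    refine ⟨_, Metric.ball_subset_interior_closedBall (Metric.mem_ball_self ?_)⟩
    exact half_pos (hVS hp).1
  have hdisj' : V.PairwiseDisjoint fun p => cube p.1 p.2 := fun p hp q hq hpq => by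
    have := hdisj hp hq hpq
    simp only [Function.onFun] at this ⊢
    rwa [hcube p hp, hcube q hq] at this
  have hsub : ⋃ p ∈ V, cube p.1 p.2 ⊆ U := by
    refine Set.iUnion₂_subset fun p hp x hx => ?_
    exact lt_maxOp_iff.2 ⟨p.1, p.2, (hVS hp).1, hx, (hVS hp).2⟩
  have hcovU : U ⊆ ⋃ p ∈ V, cube (fun i => p.1 i - 2 * p.2) ((5 : ℕ) * p.2) := by
    intro x hx
    obtain ⟨a, l, hl, hxa, h⟩ := lt_maxOp_iff.1 hx
    obtain ⟨p, hp, hp'⟩ := hcov (a, l) ⟨hl, h⟩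
    refine Set.mem_iUnion₂.2 ⟨p, hp, ?_⟩
    have h1 := hp' (by rwa [← cube_eq_closedBall _ hl.le])
    rw [cube_eq_closedBall _ (by have := (hVS hp).1; positivity)]
    convert h1 using 2
    · ext i; push_cast; ring
    · push_cast; ring
  calc t * volume U ≤ t * ∑' p : V, volume (cube (fun i => p.1.1 i - 2 * p.1.2) ((5 : ℕ) * p.1.2)) := by
        gcongr
        exact (measure_mono hcovU).trans (measure_biUnion_le _ hVc _)
    _ = 5 ^ n * ∑' p : V, t * volume (cube p.1.1 p.1.2) := by
        rw [← ENNReal.tsum_mul_left, ← ENNReal.tsum_mul_left]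
        refine tsum_congr fun p => ?_
        rw [volume_cube_mul _ p.1.1]
        push_cast
        ring
    _ ≤ 5 ^ n * ∑' p : V, ∫⁻ x in cube p.1.1 p.1.2, u x := by
        gcongr with p
        exact (hVS p.2).2.le
    _ = 5 ^ n * ∫⁻ x in ⋃ p ∈ V, cube p.1 p.2, u x := by
        rw [lintegral_biUnion hVc (fun p _ => measurableSet_cube _ _) hdisj']
    _ ≤ 5 ^ n * ∫⁻ x in U, u x := by
        gcongr

section Averages

variable {f : (Fin n → ℝ) → ℝ}

lemma enorm_average_sub_le (hf : LocallyIntegrable f volume) (a : Fin n → ℝ) {l : ℝ} (hl : 0 < l)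
    (c : ℝ) :
    ‖(⨍ y in cube a l, f y) - c‖ₑ ≤ (∫⁻ y in cube a l, ‖f y - c‖ₑ) / volume (cube a l) := by
  have hfi : IntegrableOn f (cube a l) := hf.integrableOn_isCompact (isCompact_cube a l)
  have h0 := volume_cube_ne_zero a hl
  have ht := volume_cube_ne_top a l
  have hc : IntegrableOn (fun _ => c) (cube a l) := integrableOn_const ht
  have h1 : (⨍ y in cube a l, f y) - c = ⨍ y in cube a l, (f y - c) := by
    have h2 : ⨍ _ in cube a l, c = c := setAverage_const h0 ht c
    rw [setAverage_eq] at h2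
    rw [setAverage_eq, setAverage_eq, integral_sub hfi hc, smul_sub, h2]
  rw [h1, average_eq']
  refine (enorm_integral_le_lintegral_enorm _).trans_eq ?_
  rw [lintegral_smul_measure, Measure.restrict_apply_univ, smul_eq_mul, ENNReal.div_eq_inv_mul]

lemma enorm_average_le (hf : LocallyIntegrable f volume) (a : Fin n → ℝ) {l : ℝ} (hl : 0 < l) :
    ‖⨍ y in cube a l, f y‖ₑ ≤ (∫⁻ y in cube a l, ‖f y‖ₑ) / volume (cube a l) := by
  simpa using enorm_average_sub_le hf a hl 0

lemma lintegral_sub_average_le (f : (Fin n → ℝ) → ℝ) (a : Fin n → ℝ) {l : ℝ} (hl : 0 < l) :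
    ∫⁻ x in cube a l, ‖f x - ⨍ y in cube a l, f y‖ₑ ≤ bmoNorm f * volume (cube a l) := by
  rw [← ENNReal.div_le_iff_le_mul (.inl (volume_cube_ne_zero a hl))
    (.inl (volume_cube_ne_top a l))]
  exact le_iSup₂_of_le a l (le_iSup_of_le hl le_rfl)

lemma average_sub_average_le (f : (Fin n → ℝ) → ℝ) {a b : Fin n → ℝ} {l r : ℝ} {k : ℝ≥0∞}
    (hl : 0 < l) (hr : 0 < r) (hsub : cube a l ⊆ cube b r)
    (hk : volume (cube b r) ≤ k * volume (cube a l)) :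
    (∫⁻ x in cube a l, ‖f x - ⨍ y in cube b r, f y‖ₑ) / volume (cube a l) ≤ k * bmoNorm f := by
  rw [ENNReal.div_le_iff_le_mul (.inl (volume_cube_ne_zero a hl))
    (.inl (volume_cube_ne_top a l))]
  calc _ ≤ ∫⁻ x in cube b r, ‖f x - ⨍ y in cube b r, f y‖ₑ := lintegral_mono_set hsub
    _ ≤ bmoNorm f * volume (cube b r) := lintegral_sub_average_le f b hr
    _ ≤ bmoNorm f * (k * volume (cube a l)) := by gcongr
    _ = k * bmoNorm f * volume (cube a l) := by ring

lemma enorm_average_sub_average_le (hf : LocallyIntegrable f volume) {a b : Fin n → ℝ} {l r : ℝ}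
    {k : ℝ≥0∞} (hl : 0 < l) (hr : 0 < r) (hsub : cube a l ⊆ cube b r)
    (hk : volume (cube b r) ≤ k * volume (cube a l)) :
    ‖(⨍ y in cube a l, f y) - ⨍ y in cube b r, f y‖ₑ ≤ k * bmoNorm f :=
  (enorm_average_sub_le hf a hl _).trans (average_sub_average_le f hl hr hsub hk)

lemma average_enorm_le (f : (Fin n → ℝ) → ℝ) (a : Fin n → ℝ) {l : ℝ} (hl : 0 < l) (c : ℝ) :
    (∫⁻ y in cube a l, ‖f y‖ₑ) / volume (cube a l) ≤
      (∫⁻ y in cube a l, ‖f y - c‖ₑ) / volume (cube a l) + ‖c‖ₑ := by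
  have h0 := volume_cube_ne_zero a hl
  have ht := volume_cube_ne_top a l
  rw [ENNReal.div_le_iff_le_mul (.inl h0) (.inl ht), add_mul, ENNReal.div_mul_cancel h0 ht]
  calc ∫⁻ y in cube a l, ‖f y‖ₑ ≤ ∫⁻ y in cube a l, (‖f y - c‖ₑ + ‖c‖ₑ) :=
        lintegral_mono fun y => by simpa using enorm_add_le (f y - c) c
    _ = _ := by rw [lintegral_add_right _ measurable_const, setLIntegral_const]

/-- Averages of `|f|` increase at most by a multiple of the `BMO` norm on passing to a subcube. -/
lemma average_enorm_le_of_subset (hf : LocallyIntegrable f volume) {a b : Fin n → ℝ} {l r : ℝ}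
    {k : ℝ≥0∞} (hl : 0 < l) (hr : 0 < r) (hsub : cube a l ⊆ cube b r)
    (hk : volume (cube b r) ≤ k * volume (cube a l)) :
    (∫⁻ y in cube a l, ‖f y‖ₑ) / volume (cube a l) ≤
      k * bmoNorm f + (∫⁻ y in cube b r, ‖f y‖ₑ) / volume (cube b r) :=
  (average_enorm_le f a hl (⨍ y in cube b r, f y)).trans
    (add_le_add (average_sub_average_le f hl hr hsub hk) (enorm_average_le hf b hr))

lemma average_le_essInf (u : (Fin n → ℝ) → ℝ≥0∞) {a b : Fin n → ℝ} {l r : ℝ} (hr : 0 < r)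
    (hsub : cube a l ⊆ cube b r) :
    (∫⁻ y in cube b r, u y) / volume (cube b r) ≤
      essInf (maxOp u) (volume.restrict (cube a l)) := by
  refine le_essInf_of_ae_le _ ?_
  filter_upwards [ae_restrict_mem (measurableSet_cube a l)] with x hx
  exact average_le_maxOp u hr (hsub hx)

lemma volume_cube_le_of_le {a b : Fin n → ℝ} {l r : ℝ} (k : ℕ) (h : r ≤ k * l) :
    volume (cube b r) ≤ (k : ℝ≥0∞) ^ n * volume (cube a l) := by
  rw [← volume_cube_mul b, volume_cube, volume_cube]
  gcongr

/-- Averages over cubes larger than `Q` that meet `Q`. -/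
lemma average_enorm_le_essInf_add (hf : LocallyIntegrable f volume) {a b x : Fin n → ℝ} {l r : ℝ}
    (hl : 0 < l) (hlr : l ≤ r) (hx : x ∈ cube a l) (hx' : x ∈ cube b r) :
    (∫⁻ y in cube b r, ‖f y‖ₑ) / volume (cube b r) ≤
      2 ^ n * bmoNorm f + essInf (maximalFn f) (volume.restrict (cube a l)) := by
  obtain ⟨c, h1, h2⟩ := exists_cube_superset hx hx'
  have hr : 0 < r := hl.trans_le hlr
  refine (average_enorm_le_of_subset hf (k := 2 ^ n) hr (by positivity) h2 ?_).trans ?_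
  · exact_mod_cast volume_cube_le_of_le 2 (by push_cast; linarith)
  · gcongr
    exact average_le_essInf (fun y => ‖f y‖ₑ) (by positivity) h1

end Averages

section Dyadic

/-- The half-open cube with lowest corner `a` and side length `l`. -/
def halfOpenCube (a : Fin n → ℝ) (l : ℝ) : Set (Fin n → ℝ) :=
  Set.univ.pi fun i => Set.Ico (a i) (a i + l)

lemma mem_halfOpenCube {a x : Fin n → ℝ} {l : ℝ} :
    x ∈ halfOpenCube a l ↔ ∀ i, a i ≤ x i ∧ x i < a i + l := by
  simp [halfOpenCube]

lemma measurableSet_halfOpenCube (a : Fin n → ℝ) (l : ℝ) : MeasurableSet (halfOpenCube a l) :=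
  MeasurableSet.univ_pi fun _ => measurableSet_Ico

lemma halfOpenCube_subset_cube (a : Fin n → ℝ) (l : ℝ) : halfOpenCube a l ⊆ cube a l :=
  fun _ hx => mem_cube.2 fun i => ⟨(mem_halfOpenCube.1 hx i).1, (mem_halfOpenCube.1 hx i).2.le⟩

lemma halfOpenCube_ae_eq_cube (a : Fin n → ℝ) (l : ℝ) : halfOpenCube a l =ᵐ[volume] cube a l :=
  Measure.univ_pi_Ico_ae_eq_Icc

lemma lintegral_halfOpenCube (u : (Fin n → ℝ) → ℝ≥0∞) (a : Fin n → ℝ) (l : ℝ) :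
    ∫⁻ x in halfOpenCube a l, u x = ∫⁻ x in cube a l, u x :=
  setLIntegral_congr (halfOpenCube_ae_eq_cube a l)

lemma volume_halfOpenCube (a : Fin n → ℝ) (l : ℝ) :
    volume (halfOpenCube a l) = volume (cube a l) :=
  measure_congr (halfOpenCube_ae_eq_cube a l)

/-- The lowest corners of the `2 ^ n` dyadic children of a cube. -/
noncomputable def childCorner (a : Fin n → ℝ) (l : ℝ) (ε : Fin n → Bool) : Fin n → ℝ :=
  fun i => a i + if ε i then l / 2 else 0

lemma child_subset {a : Fin n → ℝ} {l : ℝ} (hl : 0 < l) (ε : Fin n → Bool) :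
    cube (childCorner a l ε) (l / 2) ⊆ cube a l := by
  refine cube_subset_cube (fun i => ?_) fun i => ?_ <;>
  · simp only [childCorner]; split_ifs <;> linarith

lemma halfOpenCube_eq_iUnion (a : Fin n → ℝ) {l : ℝ} (hl : 0 < l) :
    halfOpenCube a l = ⋃ ε, halfOpenCube (childCorner a l ε) (l / 2) := by
  ext x
  simp only [Set.mem_iUnion, mem_halfOpenCube, childCorner]
  constructor
  · intro h
    refine ⟨fun i => decide (a i + l / 2 ≤ x i), fun i => ?_⟩
    have := h i
    by_cases hi : a i + l / 2 ≤ x i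
    · rw [if_pos (decide_eq_true hi)]
      constructor <;> linarith
    · rw [if_neg (by simpa using hi)]
      push Not at hi
      constructor <;> linarith
  · rintro ⟨ε, h⟩ i
    have := h i
    split_ifs at this <;> constructor <;> linarith

lemma pairwise_disjoint_children (a : Fin n → ℝ) (l : ℝ) :
    Pairwise (Function.onFun Disjoint fun ε => halfOpenCube (childCorner a l ε) (l / 2)) := by
  intro ε δ h
  rw [Function.onFun, Set.disjoint_left]
  intro x hx hx'
  obtain ⟨i, hi⟩ := Function.ne_iff.1 h
  have h1 := mem_halfOpenCube.1 hx i
  have h2 := mem_halfOpenCube.1 hx' i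
  simp only [childCorner] at h1 h2
  rcases Bool.eq_false_or_eq_true (ε i) with h3 | h3 <;>
  rcases Bool.eq_false_or_eq_true (δ i) with h4 | h4 <;>
  simp_all <;> linarith

lemma lintegral_eq_sum_children (u : (Fin n → ℝ) → ℝ≥0∞) (a : Fin n → ℝ) {l : ℝ} (hl : 0 < l) :
    ∫⁻ x in halfOpenCube a l, u x =
      ∑ ε, ∫⁻ x in halfOpenCube (childCorner a l ε) (l / 2), u x := by
  rw [halfOpenCube_eq_iUnion a hl, lintegral_iUnion (fun _ => measurableSet_halfOpenCube _ _)
    (pairwise_disjoint_children a l), tsum_fintype]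

/-- The lowest corner of the dyadic subcube of generation `k` containing `x`. -/
noncomputable def dyadicCorner (k : ℕ) (a : Fin n → ℝ) (l : ℝ) (x : Fin n → ℝ) : Fin n → ℝ :=
  fun i => a i + l / 2 ^ k * ⌊(x i - a i) / (l / 2 ^ k)⌋

lemma dyadicCorner_zero {a x : Fin n → ℝ} {l : ℝ} (hx : x ∈ halfOpenCube a l) :
    dyadicCorner 0 a l x = a := by
  ext i
  have h := mem_halfOpenCube.1 hx i
  have hl : 0 < l := by linarith
  have : ⌊(x i - a i) / l⌋ = 0 := by
    rw [Int.floor_eq_zero_iff, Set.mem_Ico, div_lt_one hl]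
    exact ⟨div_nonneg (by linarith) hl.le, by linarith⟩
  simp [dyadicCorner, this]

lemma dyadicCorner_child (k : ℕ) (a : Fin n → ℝ) {l : ℝ} (hl : 0 < l) (ε : Fin n → Bool)
    (x : Fin n → ℝ) :
    dyadicCorner k (childCorner a l ε) (l / 2) x = dyadicCorner (k + 1) a l x := by
  ext i
  simp only [dyadicCorner, childCorner]
  have hu : l / 2 / 2 ^ k = l / 2 ^ (k + 1) := by rw [pow_succ]; field_simp
  rw [hu]
  cases ε i
  · simp
  · have h1 : (x i - (a i + l / 2)) / (l / 2 ^ (k + 1)) =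
        (x i - a i) / (l / 2 ^ (k + 1)) - ((2 ^ k : ℤ) : ℝ) := by
      push_cast
      rw [pow_succ]
      field_simp
      ring
    simp only [if_true]
    rw [h1, Int.floor_sub_intCast]
    push_cast
    rw [pow_succ]
    field_simp
    ring

lemma mem_dyadic (k : ℕ) (a : Fin n → ℝ) {l : ℝ} (hl : 0 < l) (x : Fin n → ℝ) :
    x ∈ cube (dyadicCorner k a l x) (l / 2 ^ k) := by
  refine mem_cube.2 fun i => ?_
  have hu : 0 < l / 2 ^ k := by positivity
  have h1 := Int.floor_le ((x i - a i) / (l / 2 ^ k))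
  have h2 := (Int.lt_floor_add_one ((x i - a i) / (l / 2 ^ k))).le
  rw [le_div_iff₀ hu] at h1
  rw [div_le_iff₀ hu] at h2
  simp only [dyadicCorner]
  constructor <;> nlinarith

end Dyadic

/-- The largest deviation from `c` of the averages of `f` over the dyadic subcubes containing `x`
of generation at most `N`. -/
noncomputable def dyadicDev (f : (Fin n → ℝ) → ℝ) (N : ℕ) (a : Fin n → ℝ) (l c : ℝ)
    (x : Fin n → ℝ) : ℝ≥0∞ :=
  ⨆ (k : ℕ) (_ : k ≤ N), ‖(⨍ y in cube (dyadicCorner k a l x) (l / 2 ^ k), f y) - c‖ₑ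

lemma measurable_dyadicDev (f : (Fin n → ℝ) → ℝ) (N : ℕ) (a : Fin n → ℝ) (l c : ℝ) :
    Measurable (dyadicDev f N a l c) := by
  refine Measurable.iSup fun k => Measurable.iSup fun _ => ?_
  have h1 : Measurable fun (x : Fin n → ℝ) (i : Fin n) => ⌊(x i - a i) / (l / 2 ^ k)⌋ :=
    measurable_pi_lambda _ fun i => Int.measurable_floor.comp (by fun_prop)
  have h2 : Measurable fun m : Fin n → ℤ =>
      ‖(⨍ y in cube (fun i => a i + l / 2 ^ k * m i) (l / 2 ^ k), f y) - c‖ₑ := .of_discrete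
  exact h2.comp h1

lemma dyadicDev_mono (f : (Fin n → ℝ) → ℝ) (a : Fin n → ℝ) (l c : ℝ) :
    Monotone fun N => dyadicDev f N a l c := fun _ _ h _ =>
  iSup_mono fun _ => iSup_mono' fun hk => ⟨hk.trans h, le_rfl⟩

lemma le_dyadicDev (f : (Fin n → ℝ) → ℝ) (N : ℕ) (a : Fin n → ℝ) (l c : ℝ) (x : Fin n → ℝ) :
    ‖(⨍ y in cube (dyadicCorner N a l x) (l / 2 ^ N), f y) - c‖ₑ ≤ dyadicDev f N a l c x :=
  le_iSup₂_of_le N le_rfl le_rfl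

lemma dyadicDev_zero (f : (Fin n → ℝ) → ℝ) {a x : Fin n → ℝ} {l : ℝ} (c : ℝ)
    (hx : x ∈ halfOpenCube a l) :
    dyadicDev f 0 a l c x = ‖(⨍ y in cube a l, f y) - c‖ₑ := by
  simp [dyadicDev, dyadicCorner_zero hx]

lemma dyadicDev_succ_le (f : (Fin n → ℝ) → ℝ) (N : ℕ) {a x : Fin n → ℝ} {l : ℝ} (c : ℝ)
    (hl : 0 < l) (ε : Fin n → Bool) (hx : x ∈ halfOpenCube a l) :
    dyadicDev f (N + 1) a l c x ≤ ‖(⨍ y in cube a l, f y) - c‖ₑ ⊔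
      dyadicDev f N (childCorner a l ε) (l / 2) c x := by
  refine iSup₂_le fun k hk => ?_
  cases k with
  | zero => simp [dyadicCorner_zero hx]
  | succ k =>
    refine le_sup_of_le_right (le_iSup₂_of_le k (by lia) ?_)
    rw [dyadicCorner_child k a hl ε, div_div, ← pow_succ']

lemma dyadicDev_le_add (f : (Fin n → ℝ) → ℝ) (N : ℕ) (a : Fin n → ℝ) (l c d : ℝ)
    (x : Fin n → ℝ) : dyadicDev f N a l c x ≤ ‖d - c‖ₑ + dyadicDev f N a l d x := by
  refine iSup₂_le fun k hk => ?_
  rw [add_comm]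
  refine le_trans ?_ (add_le_add_left (le_iSup₂_of_le k hk le_rfl) _)
  simpa using enorm_add_le
    ((⨍ y in cube (dyadicCorner k a l x) (l / 2 ^ k), f y) - d) (d - c)

variable {f : (Fin n → ℝ) → ℝ}

/-- Averages over cubes of side length smaller than that of `Q`. -/
lemma average_enorm_le_dyadicDev (hf : LocallyIntegrable f volume) {a b x : Fin n → ℝ} {l r : ℝ}
    (hr : 0 < r) (hrl : r ≤ l) (hx' : x ∈ cube b r) :
    (∫⁻ y in cube b r, ‖f y‖ₑ) / volume (cube b r) ≤
      (3 ^ n + 2 ^ n) * bmoNorm f + essInf (maximalFn f) (volume.restrict (cube a l)) +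
        ⨆ N, dyadicDev f N a l (⨍ y in cube a l, f y) x := by
  have hl : 0 < l := hr.trans_le hrl
  obtain ⟨k, hk1, hk2⟩ := exists_nat_pow_near (x := l / r) (y := (2 : ℝ))
    ((one_le_div hr).2 hrl) one_lt_two
  set s := l / 2 ^ k with hs
  have hs0 : 0 < s := by positivity
  have h1 : r ≤ s := by
    rw [hs, le_div_iff₀ (by positivity), mul_comm]
    exact (le_div_iff₀ hr).1 hk1
  have h2 : s ≤ 2 * r := by
    rw [hs, div_le_iff₀ (by positivity)]
    have := (div_lt_iff₀ hr).1 hk2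
    rw [pow_succ] at this
    linarith
  obtain ⟨c, hc1, hc2⟩ := exists_cube_superset (mem_dyadic k a hl x) hx'
  have h3 : 0 < s + r := by positivity
  set A := ⨍ y in cube c (s + r), f y
  set P := ⨍ y in cube (dyadicCorner k a l x) s, f y
  set Q := ⨍ y in cube a l, f y
  have e1 : (∫⁻ y in cube b r, ‖f y - A‖ₑ) / volume (cube b r) ≤ 3 ^ n * bmoNorm f :=
    average_sub_average_le f hr h3 hc2
      (by exact_mod_cast volume_cube_le_of_le 3 (by push_cast; linarith))
  have e2 : ‖P - A‖ₑ ≤ 2 ^ n * bmoNorm f :=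
    enorm_average_sub_average_le hf hs0 h3 hc1
      (by exact_mod_cast volume_cube_le_of_le 2 (by push_cast; linarith))
  have e3 : ‖Q‖ₑ ≤ essInf (maximalFn f) (volume.restrict (cube a l)) :=
    (enorm_average_le hf a hl).trans (average_le_essInf (fun y => ‖f y‖ₑ) hl subset_rfl)
  have e4 : ‖P - Q‖ₑ ≤ ⨆ N, dyadicDev f N a l Q x := le_iSup_of_le k (le_dyadicDev f k a l Q x)
  have e5 : ‖A‖ₑ ≤ ‖P - A‖ₑ + ‖Q‖ₑ + ‖P - Q‖ₑ := by
    have : A = -(P - A) + Q + (P - Q) := by ring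
    calc ‖A‖ₑ = ‖-(P - A) + Q + (P - Q)‖ₑ := by rw [← this]
      _ ≤ ‖-(P - A)‖ₑ + ‖Q‖ₑ + ‖P - Q‖ₑ :=
        (enorm_add_le _ _).trans (add_le_add_left (enorm_add_le _ _) _)
      _ = _ := by rw [enorm_neg]
  calc _ ≤ _ := average_enorm_le f b hr A
    _ ≤ 3 ^ n * bmoNorm f + (2 ^ n * bmoNorm f +
        essInf (maximalFn f) (volume.restrict (cube a l)) + ⨆ N, dyadicDev f N a l Q x) :=
      add_le_add e1 (e5.trans (add_le_add (add_le_add e2 e3) e4))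
    _ = _ := by ring

lemma maximalFn_le_dyadicDev (hf : LocallyIntegrable f volume) {a x : Fin n → ℝ} {l : ℝ}
    (hx : x ∈ halfOpenCube a l) (hl : 0 < l) :
    maximalFn f x ≤ essInf (maximalFn f) (volume.restrict (cube a l)) +
      ((3 ^ n + 2 ^ n) * bmoNorm f + ⨆ N, dyadicDev f N a l (⨍ y in cube a l, f y) x) := by
  refine maxOp_le_iff.2 fun b r hr hx' => ?_
  rcases le_total r l with h | h
  · exact (average_enorm_le_dyadicDev hf hr h hx').trans_eq (by ring)
  · refine (average_enorm_le_essInf_add hf hl h (halfOpenCube_subset_cube a l hx) hx').trans ?_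
    rw [add_comm]
    gcongr
    rw [add_mul, add_assoc]
    exact le_self_add.trans (le_add_self)

lemma enorm_average_child_sub_le (hf : LocallyIntegrable f volume) (hB : bmoNorm f ≤ 1)
    (a : Fin n → ℝ) {l : ℝ} (hl : 0 < l) (ε : Fin n → Bool) :
    ‖(⨍ y in cube (childCorner a l ε) (l / 2), f y) - ⨍ y in cube a l, f y‖ₑ ≤ 2 ^ n := by
  refine (enorm_average_sub_average_le hf (k := 2 ^ n) (by positivity) hl (child_subset hl ε)
    ?_).trans (mul_le_of_le_one_right' hB)
  exact_mod_cast volume_cube_le_of_le 2 (by push_cast; linarith)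

/-- The stopping-time estimate for `f - c` in a cube `Q` up to generation `N`: there is a set
`Z ⊆ Q`, the union of the stopping cubes, outside of which the deviations are bounded. -/
def StoppedBound (f : (Fin n → ℝ) → ℝ) (v : (Fin n → ℝ) → ℝ≥0∞) (N : ℕ) (a : Fin n → ℝ)
    (l c : ℝ) : Prop :=
  ∃ Z ⊆ halfOpenCube a l, MeasurableSet Z ∧
    2 * volume Z ≤ ∫⁻ x in halfOpenCube a l, ‖f x - c‖ₑ ∧
    ∫⁻ x in halfOpenCube a l, (2 ⊔ dyadicDev f N a l c x) * v x ≤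
      (2 + 2 ^ n) * (∫⁻ x in halfOpenCube a l, v x) +
        2 * (2 + 2 ^ n) * ∫⁻ x in Z, maxOp ((cube a l).indicator v) x

/-- The estimate of the dyadic maximal deviation from the average by `M(v χ_Q)`. -/
def DevBound (f : (Fin n → ℝ) → ℝ) (v : (Fin n → ℝ) → ℝ≥0∞) (N : ℕ) : Prop :=
  ∀ (a : Fin n → ℝ) (l : ℝ), 0 < l →
    ∫⁻ x in halfOpenCube a l, dyadicDev f N a l (⨍ y in cube a l, f y) x * v x ≤
      2 * (2 + 2 ^ n) * ∫⁻ x in halfOpenCube a l, maxOp ((cube a l).indicator v) x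

variable {v : (Fin n → ℝ) → ℝ≥0∞}

lemma stoppedBound_of_devBound (hf : LocallyIntegrable f volume) (hv : AEMeasurable v volume)
    {N : ℕ} (h : DevBound f v N) {a : Fin n → ℝ} {l c : ℝ} (hl : 0 < l)
    (h1 : 2 ≤ ‖(⨍ y in cube a l, f y) - c‖ₑ) (h2 : ‖(⨍ y in cube a l, f y) - c‖ₑ ≤ 2 + 2 ^ n) :
    StoppedBound f v N a l c := by
  refine ⟨_, subset_rfl, measurableSet_halfOpenCube a l, ?_, ?_⟩
  · rw [volume_halfOpenCube, lintegral_halfOpenCube]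
    refine le_trans (mul_le_mul_left (h1.trans (enorm_average_sub_le hf a hl c)) _) ?_
    rw [ENNReal.div_mul_cancel (volume_cube_ne_zero a hl) (volume_cube_ne_top a l)]
  · rw [← lintegral_const_mul'' _ hv.restrict]
    refine le_trans ?_ (add_le_add_right (h a l hl) _)
    rw [← lintegral_add_left' (hv.restrict.const_mul _)]
    refine lintegral_mono fun x => ?_
    dsimp only
    rw [← add_mul]
    gcongr
    refine sup_le (le_add_right le_self_add) ?_
    exact (dyadicDev_le_add f N a l c _ x).trans (by gcongr)

lemma stoppedBound_zero (hv : AEMeasurable v volume) {a : Fin n → ℝ} {l c : ℝ}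
    (h1 : ‖(⨍ y in cube a l, f y) - c‖ₑ ≤ 2) : StoppedBound f v 0 a l c := by
  refine ⟨∅, Set.empty_subset _, .empty, by simp, ?_⟩
  rw [← lintegral_const_mul'' _ hv.restrict]
  refine le_add_right (setLIntegral_mono' (measurableSet_halfOpenCube a l) fun x hx => ?_)
  rw [dyadicDev_zero f c hx]
  gcongr
  exact sup_le le_self_add (h1.trans le_self_add)

/-- Summation of the estimates for the children. -/
lemma stoppedBound_succ {N : ℕ} {a : Fin n → ℝ} {l c : ℝ} (hl : 0 < l)
    (h : ∀ ε, StoppedBound f v N (childCorner a l ε) (l / 2) c)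
    (h1 : ‖(⨍ y in cube a l, f y) - c‖ₑ ≤ 2) : StoppedBound f v (N + 1) a l c := by
  choose Z hZ hZm hZv hZi using h
  have hdisj : Pairwise (Function.onFun Disjoint Z) := fun ε δ hne =>
    (pairwise_disjoint_children a l hne).mono (hZ ε) (hZ δ)
  refine ⟨⋃ ε, Z ε, ?_, .iUnion hZm, ?_, ?_⟩
  · rw [halfOpenCube_eq_iUnion a hl]
    exact Set.iUnion_mono hZ
  · rw [measure_iUnion hdisj hZm, tsum_fintype, Finset.mul_sum, lintegral_eq_sum_children _ a hl]
    exact Finset.sum_le_sum fun ε _ => hZv ε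
  · rw [lintegral_eq_sum_children _ a hl, lintegral_eq_sum_children v a hl,
      lintegral_iUnion hZm hdisj, tsum_fintype, Finset.mul_sum, Finset.mul_sum,
      ← Finset.sum_add_distrib]
    refine Finset.sum_le_sum fun ε _ => ?_
    calc _ ≤ ∫⁻ x in halfOpenCube (childCorner a l ε) (l / 2),
          (2 ⊔ dyadicDev f N (childCorner a l ε) (l / 2) c x) * v x := by
          refine setLIntegral_mono' (measurableSet_halfOpenCube _ _) fun x hx => ?_
          refine mul_le_mul_left ?_ _
          have hx' : x ∈ halfOpenCube a l := by
            rw [halfOpenCube_eq_iUnion a hl]; exact Set.mem_iUnion_of_mem ε hx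
          refine sup_le le_sup_left ((dyadicDev_succ_le f N c hl ε hx').trans ?_)
          exact sup_le_sup_right h1 _
      _ ≤ _ := hZi ε
      _ ≤ _ := by
          gcongr with x
          exact maxOp_mono (Set.indicator_le_indicator_of_subset (child_subset hl ε)
            fun _ => zero_le) x

lemma lintegral_le_two_mul_of_volume_le {a : Fin n → ℝ} {l : ℝ} (hl : 0 < l)
    {Z : Set (Fin n → ℝ)} (hZ : Z ⊆ halfOpenCube a l) (hZm : MeasurableSet Z)
    (hZv : 2 * volume Z ≤ volume (halfOpenCube a l)) :
    ∫⁻ x in halfOpenCube a l, v x ≤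
      2 * ∫⁻ x in halfOpenCube a l \ Z, maxOp ((cube a l).indicator v) x := by
  set q := (∫⁻ x in cube a l, v x) / volume (cube a l)
  have hvol : volume (halfOpenCube a l) ≤ 2 * volume (halfOpenCube a l \ Z) := by
    have h1 : volume (halfOpenCube a l \ Z) + volume Z = volume (halfOpenCube a l) :=
      measure_sdiff_add_inter (s := halfOpenCube a l) hZm |> fun h => by
        rwa [Set.inter_eq_right.2 hZ] at h
    have hfin : volume (halfOpenCube a l) ≠ ∞ := by
      rw [volume_halfOpenCube]; exact volume_cube_ne_top a l
    refine (ENNReal.add_le_add_iff_left hfin).1 ?_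
    calc volume (halfOpenCube a l) + volume (halfOpenCube a l)
        = 2 * volume (halfOpenCube a l \ Z) + 2 * volume Z := by
          rw [← mul_add, h1, two_mul]
      _ ≤ volume (halfOpenCube a l) + 2 * volume (halfOpenCube a l \ Z) := by
          rw [add_comm]; gcongr
  calc ∫⁻ x in halfOpenCube a l, v x = q * volume (halfOpenCube a l) := by
        rw [lintegral_halfOpenCube, volume_halfOpenCube,
          ENNReal.div_mul_cancel (volume_cube_ne_zero a hl) (volume_cube_ne_top a l)]
    _ ≤ q * (2 * volume (halfOpenCube a l \ Z)) := by gcongr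
    _ = 2 * ∫⁻ _ in halfOpenCube a l \ Z, q := by rw [setLIntegral_const]; ring
    _ ≤ _ := by
        gcongr 2 * ?_
        refine setLIntegral_mono' ((measurableSet_halfOpenCube a l).diff hZm) fun x hx => ?_
        refine le_trans (le_of_eq ?_) (average_le_maxOp _ hl (halfOpenCube_subset_cube a l hx.1))
        rw [setLIntegral_indicator (measurableSet_cube a l), Set.inter_self]

lemma devBound_succ (hf : LocallyIntegrable f volume) (hB : bmoNorm f ≤ 1) {N : ℕ}
    (h : ∀ a l c, 0 < l → ‖(⨍ y in cube a l, f y) - c‖ₑ ≤ 2 + 2 ^ n → StoppedBound f v N a l c) :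
    DevBound f v (N + 1) := by
  intro a l hl
  obtain ⟨Z, hZ, hZm, hZv, hZi⟩ := stoppedBound_succ (N := N) (v := v) hl
    (fun ε => h _ _ (⨍ y in cube a l, f y) (by positivity)
      ((enorm_average_child_sub_le hf hB a hl ε).trans le_add_self)) (by simp)
  have hZv' : 2 * volume Z ≤ volume (halfOpenCube a l) := by
    refine hZv.trans ?_
    rw [lintegral_halfOpenCube, volume_halfOpenCube]
    exact (lintegral_sub_average_le f a hl).trans (mul_le_of_le_one_left' hB)
  calc _ ≤ ∫⁻ x in halfOpenCube a l,
        (2 ⊔ dyadicDev f (N + 1) a l (⨍ y in cube a l, f y) x) * v x := by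
        gcongr; exact le_sup_right
    _ ≤ _ := hZi
    _ ≤ (2 + 2 ^ n) * (2 * ∫⁻ x in halfOpenCube a l \ Z, maxOp ((cube a l).indicator v) x) +
        2 * (2 + 2 ^ n) * ∫⁻ x in Z, maxOp ((cube a l).indicator v) x := by
        gcongr; exact lintegral_le_two_mul_of_volume_le hl hZ hZm hZv'
    _ = 2 * (2 + 2 ^ n) * ((∫⁻ x in halfOpenCube a l ∩ Z, maxOp ((cube a l).indicator v) x) +
        ∫⁻ x in halfOpenCube a l \ Z, maxOp ((cube a l).indicator v) x) := by
        rw [Set.inter_eq_right.2 hZ]; ring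
    _ = _ := by rw [lintegral_inter_add_sdiff _ _ hZm]

lemma devBound_and_stoppedBound (hf : LocallyIntegrable f volume) (hB : bmoNorm f ≤ 1)
    (hv : AEMeasurable v volume) (N : ℕ) :
    DevBound f v N ∧ ∀ a l c, 0 < l → ‖(⨍ y in cube a l, f y) - c‖ₑ ≤ 2 + 2 ^ n →
      StoppedBound f v N a l c := by
  induction N with
  | zero =>
    have hd : DevBound f v 0 := fun a l hl => by
      refine le_trans (le_of_eq ?_) zero_le
      rw [setLIntegral_congr_fun (g := fun _ => 0) (measurableSet_halfOpenCube a l)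
        fun x hx => by simp [dyadicDev_zero f _ hx]]
      simp
    refine ⟨hd, fun a l c hl hc => ?_⟩
    rcases le_total 2 ‖(⨍ y in cube a l, f y) - c‖ₑ with h | h
    · exact stoppedBound_of_devBound hf hv hd hl h hc
    · exact stoppedBound_zero hv h
  | succ N ih =>
    have hd : DevBound f v (N + 1) := devBound_succ hf hB ih.2
    refine ⟨hd, fun a l c hl hc => ?_⟩
    rcases le_total 2 ‖(⨍ y in cube a l, f y) - c‖ₑ with h | h
    · exact stoppedBound_of_devBound hf hv hd hl h hc
    · refine stoppedBound_succ hl (fun ε => ih.2 _ _ c (by positivity) ?_) h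
      have h1 := enorm_average_child_sub_le hf hB a hl ε
      calc _ = ‖((⨍ y in cube a l, f y) - c) + ((⨍ y in cube (childCorner a l ε) (l / 2), f y) -
            ⨍ y in cube a l, f y)‖ₑ := by congr 1; ring
        _ ≤ _ := (enorm_add_le _ _).trans (add_le_add h h1)

/-- The upper estimate on a single cube. -/
lemma lintegral_maximalFn_sub_essInf_le (hf : LocallyIntegrable f volume) (hB : bmoNorm f ≤ 1)
    (hv : AEMeasurable v volume) (a : Fin n → ℝ) {l : ℝ} (hl : 0 < l) :
    ∫⁻ x in cube a l, (maximalFn f x - essInf (maximalFn f) (volume.restrict (cube a l))) * v x ≤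
      (2 * (3 ^ n + 2 ^ n) + 2 * (2 + 2 ^ n)) *
        ∫⁻ x in cube a l, maxOp ((cube a l).indicator v) x := by
  set c := ⨍ y in cube a l, f y
  have hmass : ∫⁻ x in halfOpenCube a l, v x ≤
      2 * ∫⁻ x in halfOpenCube a l, maxOp ((cube a l).indicator v) x := by
    simpa using lintegral_le_two_mul_of_volume_le (v := v) hl (Set.empty_subset _) .empty (by simp)
  have hdev : ∫⁻ x in halfOpenCube a l, (⨆ N, dyadicDev f N a l c x) * v x ≤
      2 * (2 + 2 ^ n) * ∫⁻ x in halfOpenCube a l, maxOp ((cube a l).indicator v) x := by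
    simp_rw [ENNReal.iSup_mul]
    rw [lintegral_iSup' (f := fun N x => dyadicDev f N a l c x * v x) (fun N => (measurable_dyadicDev f N a l c).aemeasurable.mul
      hv.restrict) (.of_forall fun x N N' h => mul_le_mul_left (dyadicDev_mono f a l c h x) _)]
    exact iSup_le fun N => (devBound_and_stoppedBound hf hB hv N).1 a l hl
  rw [← lintegral_halfOpenCube, ← lintegral_halfOpenCube]
  calc _ ≤ ∫⁻ x in halfOpenCube a l,
        ((3 ^ n + 2 ^ n) * v x + (⨆ N, dyadicDev f N a l c x) * v x) := by
        refine setLIntegral_mono' (measurableSet_halfOpenCube a l) fun x hx => ?_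
        rw [← add_mul]
        gcongr
        rw [tsub_le_iff_left]
        refine (maximalFn_le_dyadicDev hf hx hl).trans ?_
        gcongr
        exact mul_le_of_le_one_right' hB
    _ = (3 ^ n + 2 ^ n) * (∫⁻ x in halfOpenCube a l, v x) +
        ∫⁻ x in halfOpenCube a l, (⨆ N, dyadicDev f N a l c x) * v x := by
        rw [lintegral_add_left' (hv.restrict.const_mul _), lintegral_const_mul'' _ hv.restrict]
    _ ≤ (3 ^ n + 2 ^ n) * (2 * ∫⁻ x in halfOpenCube a l, maxOp ((cube a l).indicator v) x) +
        2 * (2 + 2 ^ n) * ∫⁻ x in halfOpenCube a l, maxOp ((cube a l).indicator v) x := by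
        gcongr
    _ = _ := by ring

/-- The upper estimate for all cubes. -/
lemma bloNorm_maximalFn_le {w : (Fin n → ℝ) → ℝ} (hw : LocallyIntegrable w volume)
    (hf : LocallyIntegrable f volume) (hB : bmoNorm f ≤ 1) :
    bloNorm w (maximalFn f) ≤ (2 * (3 ^ n + 2 ^ n) + 2 * (2 + 2 ^ n)) * fujiiWilson w := by
  refine iSup₂_le fun a l => iSup_le fun hl => ?_
  refine (ENNReal.div_le_div_right (lintegral_maximalFn_sub_essInf_le hf hB
    hw.aestronglyMeasurable.aemeasurable.ennreal_ofReal a hl) _).trans ?_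
  rw [mul_div_assoc]
  gcongr
  refine le_trans ?_ (le_iSup₂_of_le a l (le_iSup_of_le hl le_rfl))
  gcongr with x
  refine maxOp_mono (fun y => ?_) x
  by_cases hy : y ∈ cube a l
  · simpa [hy] using Real.ofReal_le_enorm _
  · simp [hy]

section LevelCount

/-- The number of `k ≥ 1` such that `2 ^ k * q < g`, a discrete version of `log⁺ (g / q)`. -/
noncomputable def levelCount (q g : ℝ≥0∞) : ℝ≥0∞ :=
  ∑' k : ℕ, if 2 ^ (k + 1) * q < g then 1 else 0

lemma levelCount_mono (q : ℝ≥0∞) : Monotone (levelCount q) := fun g g' h =>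
  ENNReal.tsum_le_tsum fun k => by
    by_cases hk : 2 ^ (k + 1) * q < g
    · simp [hk, hk.trans_le h]
    · simp [hk]

variable {q : ℝ≥0∞}

lemma le_two_mul_add_tsum (hq : q ≠ 0) (g : ℝ≥0∞) :
    g ≤ 2 * q + ∑' k : ℕ, if 2 ^ (k + 1) * q < g then 2 ^ (k + 1) * q else 0 := by
  have key (N : ℕ) : min g (2 ^ (N + 1) * q) ≤
      2 * q + ∑ k ∈ Finset.range N, if 2 ^ (k + 1) * q < g then 2 ^ (k + 1) * q else 0 := by
    induction N with
    | zero => simp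
    | succ N ih =>
      rw [Finset.sum_range_succ, ← add_assoc]
      split_ifs with h
      · rw [min_eq_right h.le] at ih
        refine (min_le_right _ _).trans ?_
        rw [show 2 ^ (N + 1 + 1) * q = 2 ^ (N + 1) * q + 2 ^ (N + 1) * q by ring]
        gcongr
      · rw [min_eq_left (not_lt.1 h)] at ih
        exact (min_le_left _ _).trans (by simpa using ih)
  have hlim : Filter.Tendsto (fun N : ℕ => min g (2 ^ (N + 1) * q)) Filter.atTop (nhds g) := by
    have h1 : Filter.Tendsto (fun N : ℕ => (2 : ℝ≥0∞) ^ N) Filter.atTop (nhds ∞) :=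
      ENNReal.tendsto_pow_atTop_nhds_top_iff.2 ENNReal.one_lt_two
    have h2 : Filter.Tendsto (fun N : ℕ => (2 : ℝ≥0∞) ^ (N + 1) * q) Filter.atTop (nhds ∞) := by
      have := ENNReal.Tendsto.mul_const (b := q) ((Filter.tendsto_add_atTop_iff_nat 1).2 h1)
        (.inl ENNReal.top_ne_zero)
      rwa [ENNReal.top_mul hq] at this
    simpa using tendsto_const_nhds.min h2
  exact le_of_tendsto' hlim fun N => (key N).trans (by gcongr; exact ENNReal.sum_le_tsum _)

lemma tsum_div_le_two (hq : q ≠ 0) (hq' : q ≠ ∞) (m : ℝ≥0∞) :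
    ∑' k : ℕ, (if m ≤ 2 ^ (k + 1) * q then m / (2 ^ (k + 1) * q) else 0) ≤ 2 := by
  have hs0 (k : ℕ) : 2 ^ (k + 1) * q ≠ 0 := mul_ne_zero (by simp) hq
  have hst (k : ℕ) : 2 ^ (k + 1) * q ≠ ∞ := by finiteness
  have key (N : ℕ) :
      ∑ k ∈ Finset.range N, (if m ≤ 2 ^ (k + 1) * q then m / (2 ^ (k + 1) * q) else 0) +
        (if m ≤ 2 ^ (N + 1) * q then 2 * (m / (2 ^ (N + 1) * q)) else 0) ≤ 2 := by
    have hle (k : ℕ) : (if m ≤ 2 ^ (k + 1) * q then 2 * (m / (2 ^ (k + 1) * q)) else 0) ≤ 2 := by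
      split_ifs with h
      · refine mul_le_of_le_one_right' ?_
        rw [ENNReal.div_le_iff (hs0 k) (hst k), one_mul]
        exact h
      · simp
    induction N with
    | zero => simpa using hle 0
    | succ N ih =>
      by_cases h : m ≤ 2 ^ (N + 1) * q
      · have hsucc : 2 ^ (N + 1 + 1) * q = 2 * (2 ^ (N + 1) * q) := by ring
        have h' : m ≤ 2 ^ (N + 1 + 1) * q := by
          rw [hsucc]; exact h.trans (le_mul_of_one_le_left' one_le_two)
        rw [if_pos h] at ih
        rw [Finset.sum_range_succ, if_pos h, if_pos h', hsucc]
        have : 2 * (m / (2 * (2 ^ (N + 1) * q))) = m / (2 ^ (N + 1) * q) := by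
          rw [← mul_div_assoc, ENNReal.mul_div_mul_left _ _ two_ne_zero ENNReal.ofNat_ne_top]
        rw [this, add_assoc, ← two_mul]
        exact ih
      · rw [Finset.sum_eq_zero, zero_add]
        · exact hle _
        · intro k hk
          refine if_neg fun h' => h (h'.trans ?_)
          have : k ≤ N := by simpa [Nat.lt_succ_iff] using hk
          gcongr
          exact one_le_two
  exact ENNReal.tsum_le_of_sum_range_le fun N => le_self_add.trans (key N)

end LevelCount

section Logarithm

variable {u : (Fin n → ℝ) → ℝ≥0∞} {q : ℝ≥0∞}

lemma levelCount_maxOp_eq (u : (Fin n → ℝ) → ℝ≥0∞) (q : ℝ≥0∞) (x : Fin n → ℝ) :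
    levelCount q (maxOp u x) =
      ∑' k : ℕ, {x | 2 ^ (k + 1) * q < maxOp u x}.indicator (fun _ => 1) x := by
  simp [levelCount, Set.indicator_apply]

lemma lowerSemicontinuous_levelCount_maxOp (u : (Fin n → ℝ) → ℝ≥0∞) (q : ℝ≥0∞) :
    LowerSemicontinuous fun x => levelCount q (maxOp u x) := by
  simp_rw [levelCount_maxOp_eq]
  exact lowerSemicontinuous_tsum fun k =>
    (isOpen_lt_maxOp u _).lowerSemicontinuous_indicator zero_le

/-- A lower semicontinuous function is pointwise dominated by its maximal function. -/
lemma le_maxOp_of_lowerSemicontinuous {F : (Fin n → ℝ) → ℝ≥0∞} (hF : LowerSemicontinuous F)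
    (x : Fin n → ℝ) : F x ≤ maxOp F x := by
  refine le_of_forall_lt fun t ht => ?_
  obtain ⟨t', ht1, ht2⟩ := exists_between ht
  refine ht1.trans_le ?_
  obtain ⟨ε, hε, hsub⟩ := Metric.nhds_basis_closedBall.mem_iff.1 (hF x t' ht2)
  have hcube : cube (fun i => x i - ε) (2 * ε) ⊆ Metric.closedBall x ε := by
    rw [cube_eq_closedBall _ (by positivity)]
    refine (le_of_eq ?_)
    congr 1
    · ext i; ring
    · ring
  refine le_trans ?_ (average_le_maxOp F (a := fun i => x i - ε) (l := 2 * ε) (by positivity) ?_)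
  · rw [ENNReal.le_div_iff_mul_le (.inl (volume_cube_ne_zero _ (by positivity)))
      (.inl (volume_cube_ne_top _ _)), ← setLIntegral_const]
    exact setLIntegral_mono' (measurableSet_cube _ _) fun y hy => (hsub (hcube hy)).le
  · exact mem_cube.2 fun i => ⟨by linarith, by linarith⟩

lemma lintegral_levelCount_maxOp_le (hn : n ≠ 0) (hu : ∫⁻ x, u x ≠ ∞) (hq : q ≠ 0) (hq' : q ≠ ∞) :
    ∫⁻ x, levelCount q (maxOp u x) ≤ 2 * 5 ^ n * ((∫⁻ x, u x) / q) := by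
  have hs0 (k : ℕ) : 2 ^ (k + 1) * q ≠ 0 := mul_ne_zero (by simp) hq
  have hst (k : ℕ) : 2 ^ (k + 1) * q ≠ ∞ := by finiteness
  simp_rw [levelCount_maxOp_eq]
  rw [lintegral_tsum fun k =>
    (measurable_const.indicator (isOpen_lt_maxOp u _).measurableSet).aemeasurable]
  simp_rw [lintegral_indicator_const (isOpen_lt_maxOp u _).measurableSet, one_mul]
  calc _ ≤ ∑' k : ℕ, 5 ^ n * ((∫⁻ x, u x) / q) *
        (if q ≤ 2 ^ (k + 1) * q then q / (2 ^ (k + 1) * q) else 0) := by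
        refine ENNReal.tsum_le_tsum fun k => ?_
        rw [if_pos (le_mul_of_one_le_left' (one_le_pow₀ one_le_two)), mul_assoc,
          ← mul_div_assoc, ENNReal.div_mul_cancel hq hq', ← mul_div_assoc,
          ENNReal.le_div_iff_mul_le (.inl (hs0 k)) (.inl (hst k)), mul_comm]
        refine (mul_volume_lt_maxOp_le hn hu _).trans ?_
        gcongr
        exact Measure.restrict_le_self
    _ ≤ 5 ^ n * ((∫⁻ x, u x) / q) * 2 := by
        rw [ENNReal.tsum_mul_left]
        gcongr
        exact tsum_div_le_two hq hq' q
    _ = _ := by ring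

/-- Stein's inequality: `M u` is locally controlled by the integral of `u log⁺ (M u / q)`. -/
lemma setLIntegral_maxOp_le (hn : n ≠ 0) (hum : AEMeasurable u volume) (hu : ∫⁻ x, u x ≠ ∞)
    (hq : q ≠ 0) (s : Set (Fin n → ℝ)) :
    ∫⁻ x in s, maxOp u x ≤
      2 * q * volume s + 5 ^ n * ∫⁻ x, levelCount q (maxOp u x) * u x := by
  have hU (k : ℕ) : MeasurableSet {x | 2 ^ (k + 1) * q < maxOp u x} :=
    (isOpen_lt_maxOp u _).measurableSet
  calc ∫⁻ x in s, maxOp u x ≤ ∫⁻ x in s, (2 * q +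
        ∑' k : ℕ, {x | 2 ^ (k + 1) * q < maxOp u x}.indicator (fun _ => 2 ^ (k + 1) * q) x) := by
        refine lintegral_mono fun x => (le_two_mul_add_tsum hq (maxOp u x)).trans_eq ?_
        simp [Set.indicator_apply]
    _ = 2 * q * volume s + ∑' k : ℕ, ∫⁻ x in s,
        {x | 2 ^ (k + 1) * q < maxOp u x}.indicator (fun _ => 2 ^ (k + 1) * q) x := by
        rw [lintegral_add_left measurable_const, setLIntegral_const,
          lintegral_tsum fun k => (measurable_const.indicator (hU k)).aemeasurable]
    _ ≤ 2 * q * volume s + ∑' k : ℕ,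
        5 ^ n * ∫⁻ x, {x | 2 ^ (k + 1) * q < maxOp u x}.indicator u x := by
        refine add_le_add_right (ENNReal.tsum_le_tsum fun k => ?_) _
        rw [lintegral_indicator (hU k) u]
        refine (setLIntegral_le_lintegral _ _).trans ?_
        rw [lintegral_indicator_const (hU k)]
        exact mul_volume_lt_maxOp_le hn hu _
    _ = _ := by
        rw [ENNReal.tsum_mul_left, ← lintegral_tsum fun k => hum.indicator (hU k)]
        congr 3 with x
        rw [levelCount_maxOp_eq, ← ENNReal.tsum_mul_right]
        refine tsum_congr fun k => ?_
        simp [Set.indicator_apply]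

/-- On a cube `R`, the maximal function is controlled by a local part and by its infimum. -/
lemma maxOp_le_max {b x : Fin n → ℝ} {r : ℝ} (hr : 0 < r) (hx : x ∈ cube b r)
    {m : ℝ≥0∞} (hm : ∀ c s, 0 < s → cube b r ⊆ cube c s →
      (∫⁻ y in cube c s, u y) / volume (cube c s) ≤ m) :
    maxOp u x ≤ maxOp ((cube (fun i => b i - r) ((3 : ℕ) * r)).indicator u) x ⊔ 2 ^ n * m := by
  refine maxOp_le_iff.2 fun c s hs hxc => ?_
  rcases le_total s r with h | h
  · refine le_sup_of_le_left (le_trans (le_of_eq ?_) (average_le_maxOp _ hs hxc))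
    have hsub : cube c s ⊆ cube (fun i => b i - r) ((3 : ℕ) * r) := by
      rw [mem_cube] at hx hxc
      refine cube_subset_cube (fun i => ?_) fun i => ?_ <;>
      · have h1 := hx i
        have h2 := hxc i
        push_cast
        linarith
    rw [setLIntegral_indicator (measurableSet_cube _ _), Set.inter_eq_right.2 hsub]
  · refine le_sup_of_le_right ?_
    obtain ⟨d, h1, h2⟩ := exists_cube_superset hx hxc
    have hrs : 0 < r + s := by positivity
    have h3 := (ENNReal.div_le_iff (volume_cube_ne_zero d hrs) (volume_cube_ne_top d _)).1
      (hm d (r + s) hrs h1)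
    rw [ENNReal.div_le_iff (volume_cube_ne_zero c hs) (volume_cube_ne_top c s)]
    calc ∫⁻ y in cube c s, u y ≤ ∫⁻ y in cube d (r + s), u y := lintegral_mono_set h2
      _ ≤ m * volume (cube d (r + s)) := h3
      _ ≤ m * (2 ^ n * volume (cube c s)) := by
        gcongr
        exact_mod_cast volume_cube_le_of_le 2 (by push_cast; linarith)
      _ = _ := by ring

/-- The discrete logarithm of a maximal function exceeds its infimum over a cube by a bounded
amount on average. -/
lemma exists_setLIntegral_levelCount_le (hn : n ≠ 0) (hu : ∫⁻ x, u x ≠ ∞) (hq : q ≠ 0)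
    (hq' : q ≠ ∞) (b : Fin n → ℝ) {r : ℝ} (hr : 0 < r) :
    ∃ K : ℝ≥0∞, (∀ x ∈ cube b r, K ≤ levelCount q (maxOp u x)) ∧
      ∫⁻ x in cube b r, levelCount q (maxOp u x) ≤
        (K + 2 * (15 ^ n + 2 ^ n)) * volume (cube b r) := by
  set m := ⨅ x ∈ cube b r, maxOp u x
  have hs0 (k : ℕ) : 2 ^ (k + 1) * q ≠ 0 := mul_ne_zero (by simp) hq
  have hst (k : ℕ) : 2 ^ (k + 1) * q ≠ ∞ := by finiteness
  have hm : ∀ c s, 0 < s → cube b r ⊆ cube c s →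
      (∫⁻ y in cube c s, u y) / volume (cube c s) ≤ m := fun c s hs hsub =>
    le_iInf₂ fun x hx => average_le_maxOp u hs (hsub hx)
  set T := cube (fun i => b i - r) ((3 : ℕ) * r)
  have h3r : 0 < (3 : ℕ) * r := by positivity
  have hT : ∫⁻ x, T.indicator u x ≤ 3 ^ n * m * volume (cube b r) := by
    rw [lintegral_indicator (measurableSet_cube _ _)]
    have := hm (fun i => b i - r) ((3 : ℕ) * r) h3r
      (cube_subset_cube (fun i => by linarith) fun i => by push_cast; linarith)
    rw [ENNReal.div_le_iff (volume_cube_ne_zero _ h3r) (volume_cube_ne_top _ _),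
      volume_cube_mul _ b] at this
    exact this.trans_eq (by push_cast; ring)
  have hT' : ∫⁻ x, T.indicator u x ≠ ∞ :=
    ((lintegral_mono (Set.indicator_le_self _ _)).trans_lt hu.lt_top).ne
  set V : ℕ → Set (Fin n → ℝ) := fun k => {x | 2 ^ (k + 1) * q < maxOp (T.indicator u) x}
  have hV (k : ℕ) : MeasurableSet (V k) := (isOpen_lt_maxOp _ _).measurableSet
  set p : ℕ → ℝ≥0∞ := fun k => if m ≤ 2 ^ (k + 1) * q then m / (2 ^ (k + 1) * q) else 0
  have hp : ∑' k, p k ≤ 2 := tsum_div_le_two hq hq' m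
  have hpt : ∀ x ∈ cube b r, levelCount q (maxOp u x) ≤ levelCount q m +
      ((∑' k : ℕ, (V k).indicator (fun _ => if m ≤ 2 ^ (k + 1) * q then 1 else 0) x) +
        ∑' k : ℕ, 2 ^ n * p k) := by
    intro x hx
    have h1 := maxOp_le_max hr hx hm
    rw [levelCount, levelCount, ← ENNReal.tsum_add, ← ENNReal.tsum_add]
    refine ENNReal.tsum_le_tsum fun k => ?_
    by_cases hk : 2 ^ (k + 1) * q < maxOp u x
    · rw [if_pos hk]
      by_cases hkm : 2 ^ (k + 1) * q < m
      · rw [if_pos hkm]; exact le_self_add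
      · simp only [p, if_pos (not_lt.1 hkm)]
        rw [if_neg hkm, zero_add]
        rcases lt_sup_iff.1 (hk.trans_le h1) with h2 | h2
        · rw [Set.indicator_of_mem (show x ∈ V k from h2)]
          exact le_self_add
        · refine le_add_left ?_
          rw [← mul_div_assoc, ENNReal.le_div_iff_mul_le (.inl (hs0 k)) (.inl (hst k)), one_mul]
          exact h2.le
    · rw [if_neg hk]; exact zero_le
  refine ⟨levelCount q m, fun x hx => levelCount_mono q (iInf₂_le x hx), ?_⟩
  calc _ ≤ ∫⁻ x in cube b r, (levelCount q m +
      ((∑' k : ℕ, (V k).indicator (fun _ => if m ≤ 2 ^ (k + 1) * q then 1 else 0) x) +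
        ∑' k : ℕ, 2 ^ n * p k)) := setLIntegral_mono' (measurableSet_cube b r) hpt
    _ = levelCount q m * volume (cube b r) + ((∑' k : ℕ, ∫⁻ x in cube b r,
        (V k).indicator (fun _ => if m ≤ 2 ^ (k + 1) * q then 1 else 0) x) +
        (2 ^ n * ∑' k : ℕ, p k) * volume (cube b r)) := by
        rw [lintegral_add_left measurable_const, setLIntegral_const,
          lintegral_add_right _ measurable_const, setLIntegral_const,
          lintegral_tsum fun k => (measurable_const.indicator (hV k)).aemeasurable,
          ENNReal.tsum_mul_left]
    _ ≤ levelCount q m * volume (cube b r) + ((∑' k : ℕ, 15 ^ n * volume (cube b r) * p k) +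
        (2 ^ n * ∑' k : ℕ, p k) * volume (cube b r)) := by
        gcongr with k
        refine (setLIntegral_le_lintegral _ _).trans ?_
        rw [lintegral_indicator_const (hV k)]
        simp only [p]
        split_ifs with h
        · rw [one_mul, ← mul_div_assoc, ENNReal.le_div_iff_mul_le (.inl (hs0 k)) (.inl (hst k)),
            mul_comm]
          calc _ ≤ 5 ^ n * ∫⁻ x in V k, T.indicator u x := mul_volume_lt_maxOp_le hn hT' _
            _ ≤ 5 ^ n * (3 ^ n * m * volume (cube b r)) := by
              gcongr
              exact (setLIntegral_le_lintegral _ _).trans hT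
            _ = _ := by
              rw [show (15 : ℝ≥0∞) = 5 * 3 by norm_num, mul_pow]; ring
        · simp
    _ = (levelCount q m + (15 ^ n + 2 ^ n) * ∑' k : ℕ, p k) * volume (cube b r) := by
        rw [ENNReal.tsum_mul_left]; ring
    _ ≤ (levelCount q m + (15 ^ n + 2 ^ n) * 2) * volume (cube b r) := by gcongr
    _ = _ := by ring

end Logarithm

lemma bmoNorm_le_of_forall_exists {f : (Fin n → ℝ) → ℝ} (hf : LocallyIntegrable f volume)
    {C : ℝ≥0∞} (h : ∀ (a : Fin n → ℝ) (l : ℝ), 0 < l →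
      ∃ c : ℝ, ∫⁻ x in cube a l, ‖f x - c‖ₑ ≤ C * volume (cube a l)) :
    bmoNorm f ≤ 2 * C := by
  refine iSup₂_le fun a l => iSup_le fun hl => ?_
  obtain ⟨c, hc⟩ := h a l hl
  have h0 := volume_cube_ne_zero a hl
  have ht := volume_cube_ne_top a l
  rw [← ENNReal.div_le_iff h0 ht] at hc
  have h1 := average_enorm_le (fun x => f x - ⨍ y in cube a l, f y) a hl
    (c - ⨍ y in cube a l, f y)
  refine h1.trans ?_
  simp only [sub_sub_sub_cancel_right]
  rw [two_mul, ← enorm_neg, neg_sub]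
  exact add_le_add hc ((enorm_average_sub_le hf a hl c).trans hc)

lemma bmoNorm_le_two {f : (Fin n → ℝ) → ℝ} (hf : LocallyIntegrable f volume)
    (h : ∀ x, ‖f x‖ₑ ≤ 1) : bmoNorm f ≤ 2 := by
  refine (bmoNorm_le_of_forall_exists hf (C := 1) fun a l _ => ⟨0, ?_⟩).trans_eq (mul_one 2)
  rw [← setLIntegral_const]
  exact lintegral_mono fun x => by simpa using h x

section Scaling

lemma bmoNorm_const_mul (c : ℝ) (f : (Fin n → ℝ) → ℝ) :
    bmoNorm (fun x => c * f x) = ‖c‖ₑ * bmoNorm f := by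
  simp only [bmoNorm, ENNReal.mul_iSup]
  refine iSup_congr fun a => iSup_congr fun l => iSup_congr fun _ => ?_
  rw [← mul_div_assoc, ← lintegral_const_mul' _ _ enorm_ne_top]
  congr 1
  refine lintegral_congr fun x => ?_
  rw [← enorm_mul, mul_sub, setAverage_eq, setAverage_eq, integral_const_mul]
  simp only [smul_eq_mul]
  ring_nf

lemma maximalFn_const_mul (c : ℝ) (f : (Fin n → ℝ) → ℝ) (x : Fin n → ℝ) :
    maximalFn (fun x => c * f x) x = ‖c‖ₑ * maximalFn f x := by
  simp only [maximalFn, ENNReal.mul_iSup]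
  refine iSup_congr fun a => iSup_congr fun l => iSup_congr fun _ => iSup_congr fun _ => ?_
  rw [← mul_div_assoc, ← lintegral_const_mul' _ _ enorm_ne_top]
  simp only [enorm_mul]

lemma lowerOsc_le_mul {w : (Fin n → ℝ) → ℝ} {F G : (Fin n → ℝ) → ℝ≥0∞} {k : ℝ≥0∞} (hk : k ≠ ∞)
    (h : ∀ x, F x = k * G x) (Q : Set (Fin n → ℝ)) : lowerOsc w F Q ≤ k * lowerOsc w G Q := by
  have hess : k * essInf G (volume.restrict Q) ≤ essInf F (volume.restrict Q) := by
    refine le_essInf_of_ae_le _ ?_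
    filter_upwards [ae_essInf_le (f := G) (μ := volume.restrict Q)] with x hx
    rw [h x]
    gcongr
  rw [lowerOsc, lowerOsc, ← mul_div_assoc, ← lintegral_const_mul' _ _ hk]
  refine ENNReal.div_le_div_right (lintegral_mono fun x => ?_) _
  dsimp only
  rw [← mul_assoc, ENNReal.mul_sub fun _ _ => hk, ← h x]
  gcongr

lemma lowerOsc_eq_zero_of_bmoNorm_eq_zero {w f : (Fin n → ℝ) → ℝ}
    (hf : LocallyIntegrable f volume) (h : bmoNorm f = 0) (a : Fin n → ℝ) {l : ℝ} (hl : 0 < l) :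
    lowerOsc w (maximalFn f) (cube a l) = 0 := by
  rw [lowerOsc, setLIntegral_congr_fun (g := fun _ => 0) (measurableSet_cube a l), lintegral_zero,
    ENNReal.zero_div]
  intro x hx
  refine mul_eq_zero_of_left (tsub_eq_zero_of_le (maxOp_le_iff.2 fun b r hr hxb => ?_)) _
  obtain ⟨c, h1, h2⟩ := exists_cube_superset hx hxb
  have h3 := average_enorm_le_of_subset hf (k := volume (cube c (l + r)) / volume (cube b r)) hr
    (by positivity) h2
    (by rw [ENNReal.div_mul_cancel (volume_cube_ne_zero b hr) (volume_cube_ne_top b r)])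
  rw [h, mul_zero, zero_add] at h3
  exact h3.trans (average_le_essInf (fun y => ‖f y‖ₑ) (by positivity) h1)

/-- The supremum of the `BLO_w` seminorms of `Mf` over the admissible functions `f`. -/
noncomputable def supBlo (w : (Fin n → ℝ) → ℝ) : ℝ≥0∞ :=
  ⨆ (f : (Fin n → ℝ) → ℝ) (_ : Admissible f), bloNorm w (maximalFn f)

lemma lowerOsc_le_mul_supBlo {w f : (Fin n → ℝ) → ℝ} (hf : LocallyIntegrable f volume)
    {K : ℝ≥0∞} (hK : K ≠ ∞) (hfK : bmoNorm f ≤ K) (hfin : ∃ x, maximalFn f x ≠ ∞)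
    (a : Fin n → ℝ) {l : ℝ} (hl : 0 < l) :
    lowerOsc w (maximalFn f) (cube a l) ≤ K * supBlo w := by
  rcases eq_or_ne (bmoNorm f) 0 with h0 | h0
  · rw [lowerOsc_eq_zero_of_bmoNorm_eq_zero hf h0 a hl]
    exact zero_le
  have ht : bmoNorm f ≠ ∞ := (hfK.trans_lt hK.lt_top).ne
  set β := (bmoNorm f).toReal with hβ
  have hβ0 : 0 < β := ENNReal.toReal_pos h0 ht
  have hβe : ‖β‖ₑ = bmoNorm f := by
    rw [Real.enorm_eq_ofReal hβ0.le, hβ, ENNReal.ofReal_toReal ht]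
  have hmul : ‖β‖ₑ * ‖β⁻¹‖ₑ = 1 := by
    rw [← enorm_mul, mul_inv_cancel₀ hβ0.ne', enorm_one]
  have hadm : Admissible fun x => β⁻¹ * f x := by
    refine ⟨hf.smul β⁻¹, ?_, ?_⟩
    · rw [bmoNorm_const_mul, ← hβe, mul_comm, hmul]
    · obtain ⟨x, hx⟩ := hfin
      refine ⟨x, ?_⟩
      rw [maximalFn_const_mul]
      exact ENNReal.mul_ne_top enorm_ne_top hx
  calc lowerOsc w (maximalFn f) (cube a l)
      ≤ ‖β‖ₑ * lowerOsc w (maximalFn fun x => β⁻¹ * f x) (cube a l) := by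
        refine lowerOsc_le_mul enorm_ne_top (fun x => ?_) _
        rw [maximalFn_const_mul, ← mul_assoc, hmul, one_mul]
    _ ≤ K * supBlo w := by
        rw [hβe]
        gcongr
        exact le_iSup₂_of_le _ hadm (le_iSup₂_of_le a l (le_iSup_of_le hl le_rfl))

end Scaling

section TestFunctions

lemma essInf_maxOp_le (hn : n ≠ 0) {u : (Fin n → ℝ) → ℝ≥0∞} (hu : ∫⁻ x, u x ≠ ∞) (a : Fin n → ℝ)
    (l : ℝ) {t : ℝ≥0∞} (h : 5 ^ n * ∫⁻ x, u x < t * volume (cube a l)) :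
    essInf (maxOp u) (volume.restrict (cube a l)) ≤ t := by
  by_contra! hlt
  have h1 : volume (cube a l \ {x | t < maxOp u x}) = 0 := by
    have := ae_lt_of_lt_essInf hlt
    rw [ae_restrict_iff' (measurableSet_cube a l)] at this
    rw [← nonpos_iff_eq_zero]
    refine (measure_mono fun x hx => ?_).trans_eq this
    exact fun hx' => hx.2 (hx' hx.1)
  have h2 : volume (cube a l) ≤ volume {x | t < maxOp u x} := by
    rw [← tsub_eq_zero_iff_le]
    exact nonpos_iff_eq_zero.1 (le_measure_sdiff.trans h1.le)
  refine h.not_ge ?_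
  calc t * volume (cube a l) ≤ t * volume {x | t < maxOp u x} := by gcongr
    _ ≤ _ := mul_volume_lt_maxOp_le hn hu t
    _ ≤ _ := by gcongr; exact Measure.restrict_le_self

lemma exists_maxOp_ne_top {u : (Fin n → ℝ) → ℝ≥0∞} {μ : Measure (Fin n → ℝ)}
    (h : essInf (maxOp u) μ ≠ ∞) : ∃ x, maxOp u x ≠ ∞ := by
  by_contra! h'
  exact h (top_le_iff.1 (le_essInf_of_ae_le _ (.of_forall fun x => (h' x).ge)))

lemma exists_subcube_lintegral_le (v : (Fin n → ℝ) → ℝ≥0∞) (a : Fin n → ℝ) {l : ℝ} (hl : 0 < l)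
    (k : ℕ) : ∃ b, cube b (l / 2 ^ k) ⊆ cube a l ∧
      ∫⁻ x in cube a l, v x ≤ (2 ^ n) ^ k * ∫⁻ x in cube b (l / 2 ^ k), v x := by
  induction k with
  | zero => exact ⟨a, by simp, by simp⟩
  | succ k ih =>
    obtain ⟨b, hb, hbv⟩ := ih
    have hs : 0 < l / 2 ^ k := by positivity
    have hhalf : l / 2 ^ k / 2 = l / 2 ^ (k + 1) := by rw [pow_succ, div_div]
    obtain ⟨ε, -, hε⟩ := Finset.exists_max_image Finset.univ
      (fun ε => ∫⁻ x in cube (childCorner b (l / 2 ^ k) ε) (l / 2 ^ k / 2), v x)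
      Finset.univ_nonempty
    refine ⟨childCorner b (l / 2 ^ k) ε, ?_, ?_⟩
    · rw [← hhalf]; exact (child_subset hs ε).trans hb
    · refine hbv.trans ?_
      rw [pow_succ, mul_assoc]
      gcongr
      rw [← lintegral_halfOpenCube, lintegral_eq_sum_children v b hs, ← hhalf]
      simp_rw [lintegral_halfOpenCube]
      refine (Finset.sum_le_card_nsmul _ _ _ fun δ hδ => hε δ hδ).trans_eq ?_
      simp

/-- The seminorms of the `Mf` are bounded below, uniformly in `w`. -/
lemma one_le_mul_supBlo (hn : n ≠ 0) {w : (Fin n → ℝ) → ℝ} {a : Fin n → ℝ} {l : ℝ} (hl : 0 < l)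
    (h0 : weightMass w (cube a l) ≠ 0) (ht : weightMass w (cube a l) ≠ ∞) :
    1 ≤ 4 * 16 ^ n * supBlo w := by
  obtain ⟨b, hb, hbv⟩ := exists_subcube_lintegral_le (fun x => ENNReal.ofReal (w x)) a hl 4
  set s := l / 2 ^ 4 with hs
  have hs0 : 0 < s := by positivity
  set E := cube b s
  have hE : MeasurableSet E := measurableSet_cube b s
  set f : (Fin n → ℝ) → ℝ := E.indicator fun _ => 1
  have hfi : Integrable f volume :=
    (integrable_indicator_iff hE).2 (integrableOn_const (volume_cube_ne_top b s))
  have hfe : (fun x => ‖f x‖ₑ) = E.indicator fun _ => 1 := by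
    ext x; by_cases hx : x ∈ E <;> simp [f, hx]
  have hfint : ∫⁻ x, ‖f x‖ₑ = volume E := by
    rw [hfe, lintegral_indicator_const hE, one_mul]
  have hess : essInf (maximalFn f) (volume.restrict (cube a l)) ≤ 2⁻¹ := by
    refine essInf_maxOp_le hn (by rw [hfint]; exact volume_cube_ne_top b s) a l ?_
    have hvol : volume (cube a l) = (16 : ℕ) ^ n * volume E := by
      rw [← volume_cube_mul a]
      congr 2
      rw [hs]; norm_num
      ring
    have hnum : (5 : ℝ≥0∞) ^ n < 2⁻¹ * (16 : ℕ) ^ n := by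
      rw [mul_comm, ← div_eq_mul_inv, ENNReal.lt_div_iff_mul_lt (by simp) (by simp)]
      have : 5 ^ n * 2 < 16 ^ n := by
        obtain ⟨m, rfl⟩ := Nat.exists_eq_succ_of_ne_zero hn
        have : 5 ^ m ≤ 16 ^ m := Nat.pow_le_pow_left (by norm_num) m
        have : 0 < 5 ^ m := by positivity
        rw [pow_succ, pow_succ]
        lia
      exact_mod_cast this
    rw [hfint, hvol, ← mul_assoc]
    exact ENNReal.mul_lt_mul_left (volume_cube_ne_zero b hs0) (volume_cube_ne_top b s) hnum
  have hosc := lowerOsc_le_mul_supBlo (w := w) hfi.locallyIntegrable ENNReal.ofNat_ne_top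
    (bmoNorm_le_two hfi.locallyIntegrable fun x => by
      rw [congrFun hfe x]; exact Set.indicator_le_self' (fun _ _ => zero_le) x)
    (exists_maxOp_ne_top (hess.trans_lt (by simp)).ne) a hl
  have hlow : weightMass w (cube a l) ≤ 2 * 16 ^ n * ∫⁻ x in cube a l,
      (maximalFn f x - essInf (maximalFn f) (volume.restrict (cube a l))) *
        ENNReal.ofReal (w x) := by
    calc weightMass w (cube a l) ≤ (2 ^ n) ^ 4 * ∫⁻ x in E, ENNReal.ofReal (w x) := hbv
      _ = 2 * 16 ^ n * ∫⁻ x in E, 2⁻¹ * ENNReal.ofReal (w x) := by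
        rw [lintegral_const_mul' _ _ (by simp), mul_comm 2, mul_assoc, ← mul_assoc 2,
          ENNReal.mul_inv_cancel two_ne_zero ENNReal.ofNat_ne_top, one_mul, ← pow_mul,
          mul_comm n 4, pow_mul]
        norm_num
      _ ≤ 2 * 16 ^ n * ∫⁻ x in E,
          (maximalFn f x - essInf (maximalFn f) (volume.restrict (cube a l))) *
            ENNReal.ofReal (w x) := by
        gcongr 2 * 16 ^ n * ?_
        refine setLIntegral_mono' hE fun x hx => ?_
        gcongr
        have h1 : 1 ≤ maximalFn f x := by
          refine le_trans (le_of_eq ?_) (average_le_maxOp _ hs0 hx)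
          rw [hfe, setLIntegral_indicator hE, Set.inter_self, setLIntegral_const, one_mul,
            ENNReal.div_self (volume_cube_ne_zero b hs0) (volume_cube_ne_top b s)]
        calc (2⁻¹ : ℝ≥0∞) = 1 - 2⁻¹ := ENNReal.one_sub_inv_two.symm
          _ ≤ _ := tsub_le_tsub h1 hess
      _ ≤ _ := by gcongr
  calc (1 : ℝ≥0∞) = weightMass w (cube a l) / weightMass w (cube a l) :=
        (ENNReal.div_self h0 ht).symm
    _ ≤ 2 * 16 ^ n * lowerOsc w (maximalFn f) (cube a l) := by
        rw [lowerOsc, ← mul_div_assoc]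
        exact ENNReal.div_le_div_right hlow _
    _ ≤ 2 * 16 ^ n * (2 * supBlo w) := by gcongr
    _ = _ := by ring

/-- The function `log⁺ (M(w χ_Q) / w_Q)` tests the oscillation of the maximal function on `Q`. -/
lemma lintegral_maxOp_indicator_le (hn : n ≠ 0) {w : (Fin n → ℝ) → ℝ}
    (hw : LocallyIntegrable w volume) {a : Fin n → ℝ} {l : ℝ} (hl : 0 < l)
    (h0 : weightMass w (cube a l) ≠ 0) (ht : weightMass w (cube a l) ≠ ∞) :
    ∫⁻ x in cube a l, maxOp ((cube a l).indicator fun x => ENNReal.ofReal (w x)) x ≤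
      (2 + 5 ^ n * (4 * (15 ^ n + 2 ^ n) * supBlo w + 3 * 25 ^ n)) * weightMass w (cube a l) := by
  set Q := cube a l
  have hQ : MeasurableSet Q := measurableSet_cube a l
  have hQ0 : volume Q ≠ 0 := volume_cube_ne_zero a hl
  have hQt : volume Q ≠ ∞ := volume_cube_ne_top a l
  set W := weightMass w Q
  set v : (Fin n → ℝ) → ℝ≥0∞ := fun x => ENNReal.ofReal (w x)
  have hv : AEMeasurable v volume := hw.aestronglyMeasurable.aemeasurable.ennreal_ofReal
  set u := Q.indicator v
  have huW : ∫⁻ x, u x = W := lintegral_indicator hQ v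
  have hu : ∫⁻ x, u x ≠ ∞ := by rwa [huW]
  set q := W / volume Q
  have hq0 : q ≠ 0 := ENNReal.div_ne_zero.2 ⟨h0, hQt⟩
  have hqt : q ≠ ∞ := ENNReal.div_ne_top ht hQ0
  have hqQ : q * volume Q = W := ENNReal.div_mul_cancel hQ0 hQt
  set F : (Fin n → ℝ) → ℝ≥0∞ := fun x => levelCount q (maxOp u x) with hF
  have hFlsc : LowerSemicontinuous F := lowerSemicontinuous_levelCount_maxOp u q
  have hFm : Measurable F := hFlsc.measurable
  have hFint : ∫⁻ x, F x ≤ 2 * 5 ^ n * volume Q := by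
    refine (lintegral_levelCount_maxOp_le hn hu hq0 hqt).trans_eq ?_
    rw [huW, ← hqQ, mul_comm q, mul_div_assoc, ENNReal.div_self hq0 hqt, mul_one]
  have hFt : ∫⁻ x, F x ≠ ∞ := (hFint.trans_lt (by finiteness)).ne
  have hFfin : ∀ᵐ x, F x < ∞ := ae_lt_top hFm hFt
  set f : (Fin n → ℝ) → ℝ := fun x => (F x).toReal
  have hfe : (fun x => ‖f x‖ₑ) =ᵐ[volume] F := by
    filter_upwards [hFfin] with x hx
    rw [Real.enorm_eq_ofReal ENNReal.toReal_nonneg, ENNReal.ofReal_toReal hx.ne]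
  have hfi : Integrable f volume := integrable_toReal_of_lintegral_ne_top hFm.aemeasurable hFt
  have hMf : maximalFn f = maxOp F := maxOp_congr_ae hfe
  have hess : essInf (maximalFn f) (volume.restrict Q) ≤ 3 * 25 ^ n := by
    rw [hMf]
    refine essInf_maxOp_le hn hFt a l ?_
    calc 5 ^ n * ∫⁻ x, F x ≤ 5 ^ n * (2 * 5 ^ n * volume Q) := by gcongr
      _ = 2 * 25 ^ n * volume Q := by
        rw [show (25 : ℝ≥0∞) = 5 * 5 by norm_num, mul_pow]; ring
      _ < 3 * 25 ^ n * volume Q := by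
        refine ENNReal.mul_lt_mul_left hQ0 hQt ?_
        refine ENNReal.mul_lt_mul_left (by simp) (by simp) ?_
        norm_num
  have hbmo : bmoNorm f ≤ 4 * (15 ^ n + 2 ^ n) := by
    refine (bmoNorm_le_of_forall_exists hfi.locallyIntegrable
      (C := 2 * (15 ^ n + 2 ^ n)) fun b r hr => ?_).trans_eq (by ring)
    obtain ⟨K, hK, hKi⟩ := exists_setLIntegral_levelCount_le hn hu hq0 hqt b hr
    have hKt : K * volume (cube b r) ≠ ∞ := by
      refine ne_top_of_le_ne_top hFt ?_
      rw [← setLIntegral_const]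
      exact (setLIntegral_mono' (measurableSet_cube b r) hK).trans (setLIntegral_le_lintegral _ _)
    have hKt' : K ≠ ∞ := fun h => hKt (by rw [h, ENNReal.top_mul (volume_cube_ne_zero b hr)])
    refine ⟨K.toReal, (ENNReal.add_le_add_iff_left hKt).1 ?_⟩
    calc K * volume (cube b r) + ∫⁻ x in cube b r, ‖f x - K.toReal‖ₑ
        = ∫⁻ x in cube b r, (K + ‖f x - K.toReal‖ₑ) := by
          rw [lintegral_add_left measurable_const, setLIntegral_const]
      _ ≤ ∫⁻ x in cube b r, F x := by
          refine lintegral_mono_ae ?_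
          filter_upwards [ae_restrict_of_ae hFfin, ae_restrict_mem (measurableSet_cube b r)]
            with x hx hxR
          have h1 : K.toReal ≤ f x := ENNReal.toReal_mono hx.ne (hK x hxR)
          rw [Real.enorm_eq_ofReal (sub_nonneg.2 h1), ENNReal.ofReal_sub _ ENNReal.toReal_nonneg,
            ENNReal.ofReal_toReal hKt', ENNReal.ofReal_toReal hx.ne,
            add_tsub_cancel_of_le (hK x hxR)]
      _ ≤ _ := hKi.trans_eq (by ring)
  set e := essInf (maximalFn f) (volume.restrict Q)
  have hosc : ∫⁻ x in Q, (maximalFn f x - e) * v x ≤ 4 * (15 ^ n + 2 ^ n) * supBlo w * W := by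
    have := lowerOsc_le_mul_supBlo (w := w) hfi.locallyIntegrable (by finiteness) hbmo
      (exists_maxOp_ne_top (hess.trans_lt (by finiteness)).ne) a hl
    rwa [lowerOsc, ENNReal.div_le_iff h0 ht] at this
  have hFu : ∫⁻ x, F x * u x ≤ (4 * (15 ^ n + 2 ^ n) * supBlo w + 3 * 25 ^ n) * W := by
    calc ∫⁻ x, F x * u x = ∫⁻ x in Q, F x * v x := by
          rw [← lintegral_indicator hQ]
          refine lintegral_congr fun x => ?_
          by_cases hx : x ∈ Q <;> simp [u, hx]
      _ ≤ ∫⁻ x in Q, ((maximalFn f x - e) * v x + 3 * 25 ^ n * v x) := by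
          refine lintegral_mono fun x => ?_
          rw [← add_mul]
          gcongr
          calc F x ≤ maximalFn f x := hMf ▸ le_maxOp_of_lowerSemicontinuous hFlsc x
            _ ≤ (maximalFn f x - e) + e := le_tsub_add
            _ ≤ _ := by gcongr
      _ = (∫⁻ x in Q, (maximalFn f x - e) * v x) + 3 * 25 ^ n * W := by
          rw [lintegral_add_right' _ (hv.restrict.const_mul _), lintegral_const_mul'' _ hv.restrict]
          rfl
      _ ≤ 4 * (15 ^ n + 2 ^ n) * supBlo w * W + 3 * 25 ^ n * W := by gcongr
      _ = _ := by ring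
  calc ∫⁻ x in Q, maxOp u x ≤ 2 * q * volume Q + 5 ^ n * ∫⁻ x, F x * u x :=
        setLIntegral_maxOp_le hn (hv.indicator hQ) hu hq0 Q
    _ ≤ 2 * W + 5 ^ n * ((4 * (15 ^ n + 2 ^ n) * supBlo w + 3 * 25 ^ n) * W) := by
        rw [mul_assoc 2 q, hqQ]
        gcongr
    _ = _ := by ring

/-- The lower estimate for all cubes. -/
lemma fujiiWilson_le (hn : n ≠ 0) {w : (Fin n → ℝ) → ℝ} (hw : IsWeight w) :
    fujiiWilson w ≤ ((2 + 5 ^ n * (3 * 25 ^ n)) * (4 * 16 ^ n) +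
      5 ^ n * (4 * (15 ^ n + 2 ^ n))) * supBlo w := by
  refine iSup₂_le fun a l => iSup_le fun hl => ?_
  have hM : maximalFn ((cube a l).indicator w) =
      maxOp ((cube a l).indicator fun x => ENNReal.ofReal (w x)) := by
    refine maxOp_congr_ae ?_
    filter_upwards [hw.nonneg] with x hx
    by_cases hxQ : x ∈ cube a l
    · simp [hxQ, Real.enorm_eq_ofReal hx]
    · simp [hxQ]
  have ht : weightMass w (cube a l) ≠ ∞ :=
    (hw.locallyIntegrable.integrableOn_isCompact (isCompact_cube a l)).lintegral_lt_top.ne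
  rw [hM]
  rcases eq_or_ne (weightMass w (cube a l)) 0 with h0 | h0
  · have hzero : ∀ x, maxOp ((cube a l).indicator fun x => ENNReal.ofReal (w x)) x = 0 := by
      intro x
      refine nonpos_iff_eq_zero.1 (maxOp_le_iff.2 fun b r _ _ => ?_)
      have : ∫⁻ y in cube b r, (cube a l).indicator (fun x => ENNReal.ofReal (w x)) y = 0 := by
        refine nonpos_iff_eq_zero.1 ((setLIntegral_le_lintegral _ _).trans ?_)
        rw [lintegral_indicator (measurableSet_cube a l)]
        exact h0.le
      rw [this, ENNReal.zero_div]
    simp [hzero]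
  · rw [ENNReal.div_le_iff h0 ht]
    refine (lintegral_maxOp_indicator_le hn hw.locallyIntegrable hl h0 ht).trans ?_
    gcongr
    calc 2 + 5 ^ n * (4 * (15 ^ n + 2 ^ n) * supBlo w + 3 * 25 ^ n)
        = (2 + 5 ^ n * (3 * 25 ^ n)) * 1 + 5 ^ n * (4 * (15 ^ n + 2 ^ n)) * supBlo w := by ring
      _ ≤ (2 + 5 ^ n * (3 * 25 ^ n)) * (4 * 16 ^ n * supBlo w) +
          5 ^ n * (4 * (15 ^ n + 2 ^ n)) * supBlo w := by
        gcongr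
        exact one_le_mul_supBlo hn hl h0 ht
      _ = _ := by ring

end TestFunctions

end BLOWeights

theorem theorem2 (n : ℕ) (hn : 1 ≤ n) :
    ∃ c C : ℝ≥0, 0 < c ∧ 0 < C ∧
      ∀ w : (Fin n → ℝ) → ℝ, BLOWeights.IsWeight w →
        -- the two-sided estimate of the supremum of the `BLO_w` seminorms
        ((c : ℝ≥0∞) * BLOWeights.fujiiWilson w ≤
            ⨆ (f : (Fin n → ℝ) → ℝ) (_ : BLOWeights.Admissible f),
              BLOWeights.bloNorm w (BLOWeights.maximalFn f)) ∧
        ((⨆ (f : (Fin n → ℝ) → ℝ) (_ : BLOWeights.Admissible f),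
              BLOWeights.bloNorm w (BLOWeights.maximalFn f)) ≤
            (C : ℝ≥0∞) * BLOWeights.fujiiWilson w) ∧
        -- the same with the supremum over functions and cubes written out
        ((c : ℝ≥0∞) * BLOWeights.fujiiWilson w ≤
            ⨆ (f : (Fin n → ℝ) → ℝ) (_ : BLOWeights.Admissible f)
              (a : Fin n → ℝ) (l : ℝ) (_ : 0 < l),
              (∫⁻ x in BLOWeights.cube a l,
                (BLOWeights.maximalFn f x -
                  essInf (BLOWeights.maximalFn f) (volume.restrict (BLOWeights.cube a l))) *
                  ENNReal.ofReal (w x)) / BLOWeights.weightMass w (BLOWeights.cube a l)) ∧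
        ((⨆ (f : (Fin n → ℝ) → ℝ) (_ : BLOWeights.Admissible f)
              (a : Fin n → ℝ) (l : ℝ) (_ : 0 < l),
              (∫⁻ x in BLOWeights.cube a l,
                (BLOWeights.maximalFn f x -
                  essInf (BLOWeights.maximalFn f) (volume.restrict (BLOWeights.cube a l))) *
                  ENNReal.ofReal (w x)) / BLOWeights.weightMass w (BLOWeights.cube a l)) ≤
            (C : ℝ≥0∞) * BLOWeights.fujiiWilson w) ∧
        -- the resulting characterization of the class `A_∞`
        (BLOWeights.IsAInfty w ↔
          (⨆ (f : (Fin n → ℝ) → ℝ) (_ : BLOWeights.Admissible f),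
              BLOWeights.bloNorm w (BLOWeights.maximalFn f)) < ∞) := by
  set C : ℝ≥0 := 2 * (3 ^ n + 2 ^ n) + 2 * (2 + 2 ^ n) with hC
  set D : ℝ≥0 := (2 + 5 ^ n * (3 * 25 ^ n)) * (4 * 16 ^ n) + 5 ^ n * (4 * (15 ^ n + 2 ^ n)) with hD
  have hC0 : 0 < C := by positivity
  have hD0 : 0 < D := by positivity
  refine ⟨D⁻¹, C, inv_pos.2 hD0, hC0, fun w hw => ?_⟩
  have upper : BLOWeights.supBlo w ≤ (C : ℝ≥0∞) * BLOWeights.fujiiWilson w := by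
    refine iSup₂_le fun f hf => ?_
    refine (BLOWeights.bloNorm_maximalFn_le hw.locallyIntegrable hf.1 hf.2.1.le).trans_eq ?_
    rw [hC]; push_cast; rfl
  have lower' : BLOWeights.fujiiWilson w ≤ (D : ℝ≥0∞) * BLOWeights.supBlo w := by
    refine (BLOWeights.fujiiWilson_le (by lia) hw).trans_eq ?_
    rw [hD]; push_cast; rfl
  have lower : ((D⁻¹ : ℝ≥0) : ℝ≥0∞) * BLOWeights.fujiiWilson w ≤ BLOWeights.supBlo w := by
    rw [ENNReal.coe_inv hD0.ne', mul_comm, ← div_eq_mul_inv]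
    exact ENNReal.div_le_of_le_mul' lower'
  refine ⟨lower, upper, lower, upper, fun h => ?_, fun h => ⟨hw, ?_⟩⟩
  · exact upper.trans_lt (ENNReal.mul_lt_top ENNReal.coe_lt_top h.2)
  · exact lower'.trans_lt (ENNReal.mul_lt_top ENNReal.coe_lt_top h)
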